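/- Let $\mathbf V$ be a complex vector space with a countable basis $E=(e_\ell)_{\ell\in\mathbb N^*}$, $\mathbb N^*=\{1,2,\dots\}$; write $x\mapsto\bar x$ for complex conjugation of coordinates in $E$, and identify vectors with coordinate columns. Let $\mathbf G(E)$ be the group of automorphisms $g$ of $\mathbf V$ with $g(e_\ell)=e_\ell$ for all but finitely many $\ell$. Let $\Omega$ be a block diagonal $\mathbb N^*\times\mathbb N^*$-matrix with diagonal blocks $J_1,J_2,\dots$, where either each $J_k$ is $(1)$ or $\begin{pmatrix}0&1\\1&0\end{pmatrix}$ (orthogonal case), or each $J_k$ is $\begin{pmatrix}0&1\\-1&0\end{pmatrix}$ (symplectic case). Put $\omega(x,y)={}^tx\,\Omega\,y$, $\gamma(x)=\Omega\bar x$ and $\mathbf G(E,\omega)=\{g\in\mathbf G(E):\omega(gx,gy)=\omega(x,y)\ \forall x,y\}$; for $\ell\in\mathbb N^*$ let $\ell^*$ be the unique index with $\omega(e_\ell,e_{\ell^*})\neq0$. For a decomposition $\mathbb N^*=N_+\sqcup N_-$ let $\Phi$ be the diagonal matrix with entry $1$ at $\ell\in N_+$ and $-1$ at $\ell\in N_-$,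 and put $\phi(x,y)={}^t\bar x\,\Phi\,y$, $\delta(x)=\Phi x$. Let $(\mathbf G,\mathbf K,\mathbf G^0)$ be one of the following triples. - Type A1 ($\omega$ orthogonal) and type A2 ($\omega$ symplectic): $\mathbf G=\mathbf G(E)$, $\mathbf K=\mathbf G(E,\omega)$, $\mathbf G^0=\{g\in\mathbf G:\gamma g=g\gamma\}$. - Type A3: $\mathbf G=\mathbf G(E)$, $N_+$ and $N_-$ are nonempty, $\mathbf K=\{g\in\mathbf G:\delta g=g\delta\}$, $\mathbf G^0=\{g\in\mathbf G:\phi(gx,gy)=\phi(x,y)\ \forall x,y\}$. - Type BD1 ($\omega$ orthogonal) and type C2 ($\omega$ symplectic): $\mathbf G=\mathbf G(E,\omega)$, $N_+$ and $N_-$ are nonempty, $\ell\in N_+\Leftrightarrow\ell^*\in N_+$ for all $\ell$, and $\mathbf K,\mathbf G^0$ are given by the same formulas as in type A3. - Type D3 ($\omega$ orthogonal) and type C1 ($\omega$ symplectic): $\mathbf G=\mathbf G(E,\omega)$, $\ell\in N_+\Leftrightarrow\ell^*\in N_-$ for all $\ell$, and $\mathbf K,\mathbf G^0$ are given by the same formulas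 as in type A3. A generalized flag is a chain $\mathcal F$ of subspaces of $\mathbf V$ such that every $F\in\mathcal F$ has an immediate successor or an immediate predecessor in $\mathcal F$, and every nonzero $v\in\mathbf V$ lies in $s(F)\setminus F$ for exactly one $F\in\mathcal F$ having an immediate successor $s(F)$. It is maximal if it is not properly contained in another generalized flag. It is $E$-compatible if there is a surjection $\sigma$ of $\mathbb N^*$ onto a totally ordered set $(A,\prec)$ such that $\mathcal F=\{F'_a,F''_a:a\in A\}$ with $F'_a=\langle e_\ell:\sigma(\ell)\prec a\rangle_{\mathbb C}$ and $F''_a=\langle e_\ell:\sigma(\ell)\preceq a\rangle_{\mathbb C}$. It is $\omega$-isotropic if $F\mapsto F^\perp=\{x\in\mathbf V:\omega(x,y)=0\ \forall y\in F\}$ is a well-defined involution of $\mathcal F$. Let $\mathcal F$ be an $E$-compatible maximal generalized flag, which is moreover $\omega$-isotropic in types BD1, C1, C2, D3. Let $\mathbf B_{\mathcal F}=\{g\in\mathbf G:g\mathcal F=\mathcal F\}$ and $\mathbf X=\mathbf G/\mathbf B_{\mathcal F}$. Then the set $\mathbf X/\mathbf K$ of $\mathbf K$-orbits on $\mathbf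 X$ and the set $\mathbf X/\mathbf G^0$ of $\mathbf G^0$-orbits on $\mathbf X$ are both infinite. -/

import Mathlib

open scoped Pointwise

namespace IndFlag

section Flags

variable {V : Type*} [AddCommGroup V] [Module ℂ V]

/-- `H` is the immediate successor of `F` in the chain `𝓕`
(equivalently, `F` is the immediate predecessor of `H`). -/
def IsSucc (𝓕 : Set (Submodule ℂ V)) (F H : Submodule ℂ V) : Prop :=
  F ∈ 𝓕 ∧ H ∈ 𝓕 ∧ F < H ∧ ∀ L ∈ 𝓕, ¬ (F < L ∧ L < H)

/-- A generalized flag: a chain of subspaces, each of which has an immediate successor or an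
immediate predecessor, such that every nonzero vector lies in `s(F) \ F` for a unique member `F`
having an immediate successor `s(F)`. -/
structure IsGeneralizedFlag (𝓕 : Set (Submodule ℂ V)) : Prop where
  chain : IsChain (· ≤ ·) 𝓕
  succ_or_pred : ∀ F ∈ 𝓕, (∃ H, IsSucc 𝓕 F H) ∨ (∃ H, IsSucc 𝓕 H F)
  unique_step : ∀ v : V, v ≠ 0 → ∃! F, ∃ H, IsSucc 𝓕 F H ∧ v ∈ H ∧ v ∉ F

/-- A generalized flag that is not properly contained in another generalized flag. -/
def IsMaximalGeneralizedFlag (𝓕 : Set (Submodule ℂ V)) : Prop :=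
  IsGeneralizedFlag 𝓕 ∧ ∀ 𝓗 : Set (Submodule ℂ V), IsGeneralizedFlag 𝓗 → 𝓕 ⊆ 𝓗 → 𝓗 = 𝓕

/-- The generalized flag `𝓕_σ(v) = {F'_a, F''_a : a ∈ A}`, where `F'_a` is spanned by the `v ℓ`
with `σ ℓ < a` and `F''_a` by those with `σ ℓ ≤ a`. -/
def flagOf {A : Type} [LinearOrder A] (σ : ℕ+ → A) (v : ℕ+ → V) : Set (Submodule ℂ V) :=
  {F | ∃ a : A, F = Submodule.span ℂ (v '' {ℓ | σ ℓ < a}) ∨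
    F = Submodule.span ℂ (v '' {ℓ | σ ℓ ≤ a})}

/-- Compatibility with a basis. Since `A` is an image of `ℕ+`, it is no loss to take `A : Type`. -/
def IsCompatible (𝓕 : Set (Submodule ℂ V)) (E : Module.Basis ℕ+ ℂ V) : Prop :=
  ∃ (A : Type) (_ : LinearOrder A) (σ : ℕ+ → A), Function.Surjective σ ∧ 𝓕 = flagOf σ E

/-- The orthogonal subspace `F^⊥ = {x : ω(x, y) = 0 for all y ∈ F}`. -/
def perp (ω : V →ₗ[ℂ] V →ₗ[ℂ] ℂ) (F : Submodule ℂ V) : Submodule ℂ V where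
  carrier := {x | ∀ y ∈ F, ω x y = 0}
  add_mem' := by
    intro a b ha hb y hy
    simp [ha y hy, hb y hy]
  zero_mem' := by
    intro y _
    simp
  smul_mem' := by
    intro c x hx y hy
    simp [hx y hy]

/-- `F ↦ F^⊥` is a well-defined involution of `𝓕`. -/
def IsIsotropicFlag (ω : V →ₗ[ℂ] V →ₗ[ℂ] ℂ) (𝓕 : Set (Submodule ℂ V)) : Prop :=
  ∀ F ∈ 𝓕, perp ω F ∈ 𝓕 ∧ perp ω (perp ω F) = F

end Flags

section Forms

/-- The permutation `ℓ ↦ ℓ*` attached to a decomposition of `ℕ+` into consecutive blocks of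
size 1 or 2: it fixes the blocks of size 1 and exchanges the two elements of each block of
size 2. These are exactly the involutions with `ℓ* ∈ {ℓ - 1, ℓ, ℓ + 1}` for all `ℓ`. -/
def IsBlockInvolution (ι : ℕ+ → ℕ+) : Prop :=
  ∀ ℓ, ι (ι ℓ) = ℓ ∧ ι ℓ ≤ ℓ + 1 ∧ ℓ ≤ ι ℓ + 1

/-- The block diagonal matrix `Ω` with blocks `(1)` and `(0, 1; c, 0)` placed according to `ι`.
It is used with `c = 1` (orthogonal case), and with `c = -1` and `ι` without fixed points
(symplectic case). -/
def Omega (c : ℂ) (ι : ℕ+ → ℕ+) : Matrix ℕ+ ℕ+ ℂ :=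
  fun i j => if j = ι i then (if i ≤ j then 1 else c) else 0

open Classical in
/-- The diagonal entries of `Φ`: `1` on `N₊ = N` and `-1` on `N₋ = Nᶜ`. -/
noncomputable def sgn (N : Set ℕ+) (ℓ : ℕ+) : ℂ := if ℓ ∈ N then 1 else -1

variable {V : Type*} [AddCommGroup V] [Module ℂ V]

/-- The bilinear form `ω(x, y) = ᵗx Ω y` in coordinates with respect to `E`. -/
noncomputable def omegaForm (E : Module.Basis ℕ+ ℂ V) (c : ℂ) (ι : ℕ+ → ℕ+) :
    V →ₗ[ℂ] V →ₗ[ℂ] ℂ :=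
  E.constr ℂ fun i => E.constr ℂ fun j => Omega c ι i j

/-- The antilinear map `γ(x) = Ω x̄`; the only nonzero entry of column `j` of `Ω` is in
row `ι j`. -/
noncomputable def gammaMap (E : Module.Basis ℕ+ ℂ V) (c : ℂ) (ι : ℕ+ → ℕ+) (x : V) : V :=
  (E.repr x).sum fun j a => (Omega c ι (ι j) j * starRingEnd ℂ a) • E (ι j)

/-- The Hermitian form `φ(x, y) = ᵗx̄ Φ y`. -/
noncomputable def phiForm (E : Module.Basis ℕ+ ℂ V) (N : Set ℕ+) (x y : V) : ℂ :=
  (E.repr x).sum fun ℓ a => starRingEnd ℂ a * sgn N ℓ * E.repr y ℓ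

/-- The involution `δ(x) = Φ x`. -/
noncomputable def deltaMap (E : Module.Basis ℕ+ ℂ V) (N : Set ℕ+) : V →ₗ[ℂ] V :=
  E.constr ℂ fun ℓ => sgn N ℓ • E ℓ

end Forms

section Groups

variable {V : Type*} [AddCommGroup V] [Module ℂ V]

/-- The ind-group `GL(∞) = 𝐆(E)` of automorphisms of `V` that fix `e_ℓ` for all but finitely
many `ℓ`. -/
def GLinf (E : Module.Basis ℕ+ ℂ V) : Subgroup (V ≃ₗ[ℂ] V) where
  carrier := {g | ∀ᶠ ℓ in Filter.atTop, g (E ℓ) = E ℓ}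
  mul_mem' := by
    intro a b ha hb
    filter_upwards [ha, hb] with ℓ h₁ h₂
    simp [LinearEquiv.mul_apply, h₁, h₂]
  one_mem' := by simp
  inv_mem' := by
    intro a ha
    filter_upwards [ha] with ℓ h
    exact (LinearEquiv.symm_apply_eq a).2 h.symm

/-- The automorphisms `g` with `b(gx, gy) = b(x, y)` for all `x, y`. -/
def preserving (b : V → V → ℂ) : Subgroup (V ≃ₗ[ℂ] V) where
  carrier := {g | ∀ x y, b (g x) (g y) = b x y}
  mul_mem' := by
    intro g h hg hh x y
    simp only [LinearEquiv.mul_apply]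
    rw [hg, hh]
  one_mem' := by
    intro x y
    rfl
  inv_mem' := by
    intro g hg x y
    have h := hg (g.symm x) (g.symm y)
    rw [LinearEquiv.apply_symm_apply, LinearEquiv.apply_symm_apply] at h
    exact h.symm

/-- The automorphisms `g` with `f(gx) = g f(x)` for all `x`. -/
def commuting (f : V → V) : Subgroup (V ≃ₗ[ℂ] V) where
  carrier := {g | ∀ x, f (g x) = g (f x)}
  mul_mem' := by
    intro g h hg hh x
    simp only [LinearEquiv.mul_apply]
    rw [hg, hh]
  one_mem' := by
    intro x
    rfl
  inv_mem' := by
    intro g hg x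
    have h := hg (g.symm x)
    rw [LinearEquiv.apply_symm_apply] at h
    exact ((LinearEquiv.symm_apply_eq g).2 h).symm

/-- The group `𝐆(E, ω)`. -/
noncomputable def Ginf (E : Module.Basis ℕ+ ℂ V) (c : ℂ) (ι : ℕ+ → ℕ+) :
    Subgroup (V ≃ₗ[ℂ] V) :=
  GLinf E ⊓ preserving fun x y => omegaForm E c ι x y

/-- The stabilizer of `𝓕` in `V ≃ₗ[ℂ] V`, where `g` acts on sets of subspaces by
`g 𝓕 = {g(F) : F ∈ 𝓕}`. -/
def flagStabilizer (𝓕 : Set (Submodule ℂ V)) : Subgroup (V ≃ₗ[ℂ] V) :=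
  MulAction.stabilizer (V ≃ₗ[ℂ] V) 𝓕

/-- The set `(G/B_𝓕)/H` of orbits of a subgroup `H ⊆ G` acting by left multiplication on `G/B_𝓕`,
where `B_𝓕` is the stabilizer of `𝓕` in `G`. -/
abbrev OrbitSet (G H : Subgroup (V ≃ₗ[ℂ] V)) (𝓕 : Set (Submodule ℂ V)) : Type _ :=
  MulAction.orbitRel.Quotient (H.subgroupOf G) (G ⧸ (flagStabilizer 𝓕).subgroupOf G)

end Groups

/-- The seven types, with the data they depend on: the position `ι` of the blocks of `Ω` (where
needed) and the decomposition `N₊ = N`, `N₋ = Nᶜ` (where needed). -/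
inductive Datum : Type
  | A1 (ι : ℕ+ → ℕ+) (block : IsBlockInvolution ι)
  | A2 (ι : ℕ+ → ℕ+) (block : IsBlockInvolution ι) (noFix : ∀ ℓ, ι ℓ ≠ ℓ)
  | A3 (N : Set ℕ+) (pos : N.Nonempty) (neg : Nᶜ.Nonempty)
  | BD1 (ι : ℕ+ → ℕ+) (block : IsBlockInvolution ι)
      (N : Set ℕ+) (pos : N.Nonempty) (neg : Nᶜ.Nonempty) (stable : ∀ ℓ, ℓ ∈ N ↔ ι ℓ ∈ N)
  | C1 (ι : ℕ+ → ℕ+) (block : IsBlockInvolution ι) (noFix : ∀ ℓ, ι ℓ ≠ ℓ)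
      (N : Set ℕ+) (swap : ∀ ℓ, ℓ ∈ N ↔ ι ℓ ∈ Nᶜ)
  | C2 (ι : ℕ+ → ℕ+) (block : IsBlockInvolution ι) (noFix : ∀ ℓ, ι ℓ ≠ ℓ)
      (N : Set ℕ+) (pos : N.Nonempty) (neg : Nᶜ.Nonempty) (stable : ∀ ℓ, ℓ ∈ N ↔ ι ℓ ∈ N)
  | D3 (ι : ℕ+ → ℕ+) (block : IsBlockInvolution ι)
      (N : Set ℕ+) (swap : ∀ ℓ, ℓ ∈ N ↔ ι ℓ ∈ Nᶜ)

namespace Datum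

variable {V : Type*} [AddCommGroup V] [Module ℂ V]

/-- The classical ind-group `𝐆`. -/
noncomputable def G (D : Datum) (E : Module.Basis ℕ+ ℂ V) : Subgroup (V ≃ₗ[ℂ] V) :=
  match D with
  | A1 _ _ => GLinf E
  | A2 _ _ _ => GLinf E
  | A3 _ _ _ => GLinf E
  | BD1 ι _ _ _ _ _ => Ginf E 1 ι
  | C1 ι _ _ _ _ => Ginf E (-1) ι
  | C2 ι _ _ _ _ _ _ => Ginf E (-1) ι
  | D3 ι _ _ _ => Ginf E 1 ι

/-- The symmetric ind-subgroup `𝐊 ⊆ 𝐆`. -/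
noncomputable def K (D : Datum) (E : Module.Basis ℕ+ ℂ V) : Subgroup (V ≃ₗ[ℂ] V) :=
  match D with
  | A1 ι _ => Ginf E 1 ι
  | A2 ι _ _ => Ginf E (-1) ι
  | A3 N _ _ => GLinf E ⊓ commuting (deltaMap E N)
  | BD1 ι _ N _ _ _ => Ginf E 1 ι ⊓ commuting (deltaMap E N)
  | C1 ι _ _ N _ => Ginf E (-1) ι ⊓ commuting (deltaMap E N)
  | C2 ι _ _ N _ _ _ => Ginf E (-1) ι ⊓ commuting (deltaMap E N)
  | D3 ι _ N _ => Ginf E 1 ι ⊓ commuting (deltaMap E N)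

/-- The real form `𝐆⁰ ⊆ 𝐆`. -/
noncomputable def G0 (D : Datum) (E : Module.Basis ℕ+ ℂ V) : Subgroup (V ≃ₗ[ℂ] V) :=
  match D with
  | A1 ι _ => GLinf E ⊓ commuting (gammaMap E 1 ι)
  | A2 ι _ _ => GLinf E ⊓ commuting (gammaMap E (-1) ι)
  | A3 N _ _ => GLinf E ⊓ preserving (phiForm E N)
  | BD1 ι _ N _ _ _ => Ginf E 1 ι ⊓ preserving (phiForm E N)
  | C1 ι _ _ N _ => Ginf E (-1) ι ⊓ preserving (phiForm E N)
  | C2 ι _ _ N _ _ _ => Ginf E (-1) ι ⊓ preserving (phiForm E N)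
  | D3 ι _ N _ => Ginf E 1 ι ⊓ preserving (phiForm E N)

/-- The isotropy condition on flags: none in type A, `ω`-isotropic in types B, C, D. -/
def IsotropyCondition (D : Datum) (E : Module.Basis ℕ+ ℂ V) (𝓕 : Set (Submodule ℂ V)) : Prop :=
  match D with
  | A1 _ _ => True
  | A2 _ _ _ => True
  | A3 _ _ _ => True
  | BD1 ι _ _ _ _ _ => IsIsotropicFlag (omegaForm E 1 ι) 𝓕
  | C1 ι _ _ _ _ => IsIsotropicFlag (omegaForm E (-1) ι) 𝓕
  | C2 ι _ _ _ _ _ _ => IsIsotropicFlag (omegaForm E (-1) ι) 𝓕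
  | D3 ι _ _ _ => IsIsotropicFlag (omegaForm E 1 ι) 𝓕

end Datum

end IndFlag

namespace IndFlag

/-! ### Chains of subspaces, maximal flags and isotropic flags. -/

section Chains

variable {V : Type*} [AddCommGroup V] [Module ℂ V]

/-! Write `⟨x, y⟩` for the standard Hermitian form `herm` of the basis. Each type comes with a
semilinear map `f`: the antilinear `γ` in types A1 and A2, the linear `δ` in the others. Since `ω(y,
x) = ⟨γ x, y⟩` and `φ(x, y) = ⟨δ x, y⟩`, one of `𝐊` and `𝐆⁰` commutes with `f` and the other
preserves `⟨f x, y⟩`. Both are treated at once in `infinite_orbitSets`.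

The invariant separating orbits is a permutation `w`, carried by a unitary `g ∈ 𝐆` for which `f`
permutes the lines `ℂ g e_ℓ` according to `w` (`IsMonomialAt`). If the cosets of `g₁` and `g₂` lie
in one orbit, some `u = g₂⁻¹ k g₁` stabilizes the flag. Being finitary, `u` stabilizes every member
of it (`smul_eq_of_smul_mem_chain`). By maximality the steps have dimension one
(`injective_of_isMaximal`), so `u` is triangular with nonzero diagonal for the order on the basis
given by `σ`. As in the uniqueness part of a Bruhat decomposition, a triangular `u` relating two
monomial maps, or two monomial forms, forces `w₁ = w₂` (`perm_eq_of_commuting`,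
`perm_eq_of_preserving`).

It remains to realize infinitely many `w`. One unitary reflection, or two commuting ones exchanged
by `γ`, suffice: they either transpose basis vectors, or mix vectors so that `f` exchanges two of
the new lines. -/

theorem IsSucc.le_of_lt {𝓕 : Set (Submodule ℂ V)} (hc : IsChain (· ≤ ·) 𝓕) {F M L : Submodule ℂ V}
    (h : IsSucc 𝓕 F M) (hL : L ∈ 𝓕) (hFL : F < L) : M ≤ L := by
  rcases hc.total h.2.1 hL with h' | h'
  · exact h'
  · rcases h'.eq_or_lt with e | l
    · exact e.ge
    · exact absurd ⟨hFL, l⟩ (h.2.2.2 L hL)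

theorem IsSucc.le_or_le {𝓕 : Set (Submodule ℂ V)} (hc : IsChain (· ≤ ·) 𝓕) {F M L : Submodule ℂ V}
    (h : IsSucc 𝓕 F M) (hL : L ∈ 𝓕) : L ≤ F ∨ M ≤ L := by
  rcases hc.total hL h.1 with h' | h'
  · exact Or.inl h'
  · rcases h'.eq_or_lt with e | l
    · exact Or.inl e.ge
    · exact Or.inr (h.le_of_lt hc hL l)

/-- In a chain, the step containing a given vector is unique. -/
theorem step_unique {𝓕 : Set (Submodule ℂ V)} (hc : IsChain (· ≤ ·) 𝓕) {v : V}
    {F M F' M' : Submodule ℂ V} (h : IsSucc 𝓕 F M) (h' : IsSucc 𝓕 F' M')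
    (hM : v ∈ M) (hF : v ∉ F) (hM' : v ∈ M') (hF' : v ∉ F') : F = F' := by
  by_contra hne
  rcases hc.total h.1 h'.1 with l | l
  · exact hF' (h.le_of_lt hc h'.1 (lt_of_le_of_ne l hne) hM)
  · exact hF (h'.le_of_lt hc h.1 (lt_of_le_of_ne l (Ne.symm hne)) hM')

/-- A subspace strictly inside a step of a generalized flag can be added to it. -/
theorem IsGeneralizedFlag.insert {𝓕 : Set (Submodule ℂ V)} (hF : IsGeneralizedFlag 𝓕)
    {F M H : Submodule ℂ V} (h : IsSucc 𝓕 F M) (hFH : F < H) (hHM : H < M) :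
    IsGeneralizedFlag (insert H 𝓕) := by
  have hc := hF.chain
  have hcomp : ∀ L ∈ 𝓕, L ≤ F ∨ M ≤ L := fun L hL => h.le_or_le hc hL
  have hchain : IsChain (· ≤ ·) (Insert.insert H 𝓕) := by
    refine hc.insert fun L hL _ => ?_
    rcases hcomp L hL with h' | h'
    · exact Or.inr (h'.trans hFH.le)
    · exact Or.inl (hHM.le.trans h')
  have h1 : IsSucc (Insert.insert H 𝓕) F H := by
    refine ⟨Or.inr h.1, Or.inl rfl, hFH, ?_⟩
    rintro L (rfl | hL) ⟨ha, hb⟩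
    · exact lt_irrefl _ hb
    · exact h.2.2.2 L hL ⟨ha, hb.trans hHM⟩
  have h2 : IsSucc (Insert.insert H 𝓕) H M := by
    refine ⟨Or.inl rfl, Or.inr h.2.1, hHM, ?_⟩
    rintro L (rfl | hL) ⟨ha, hb⟩
    · exact lt_irrefl _ ha
    · exact h.2.2.2 L hL ⟨hFH.trans ha, hb⟩
  -- Inserting `H` breaks only the step from `F` to `M`: the ends of any other step lie on the same
  -- side of `H`.
  have h3 : ∀ L N, IsSucc 𝓕 L N → IsSucc (Insert.insert H 𝓕) L N ∨ (L = F ∧ N = M) := by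
    intro L N hLN
    by_cases hL : H ≤ L
    · refine Or.inl ⟨Or.inr hLN.1, Or.inr hLN.2.1, hLN.2.2.1, ?_⟩
      rintro K (rfl | hK) hb
      · exact absurd hL hb.1.not_ge
      · exact hLN.2.2.2 K hK hb
    by_cases hN : N ≤ H
    · refine Or.inl ⟨Or.inr hLN.1, Or.inr hLN.2.1, hLN.2.2.1, ?_⟩
      rintro K (rfl | hK) hb
      · exact absurd hN hb.2.not_ge
      · exact hLN.2.2.2 K hK hb
    have hLF : L ≤ F := (hcomp L hLN.1).resolve_right fun h' => hL (hHM.le.trans h')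
    have hMN : M ≤ N := (hcomp N hLN.2.1).resolve_left fun h' => hN (h'.trans hFH.le)
    refine Or.inr ⟨?_, ?_⟩
    · by_contra hne
      exact hLN.2.2.2 F h.1 ⟨lt_of_le_of_ne hLF hne, h.2.2.1.trans_le hMN⟩
    · by_contra hne
      exact hLN.2.2.2 M h.2.1 ⟨hLF.trans_lt h.2.2.1, lt_of_le_of_ne hMN (Ne.symm hne)⟩
  refine ⟨hchain, ?_, ?_⟩
  · rintro L (rfl | hL)
    · exact Or.inl ⟨M, h2⟩
    · rcases hF.succ_or_pred L hL with ⟨N, hN⟩ | ⟨N, hN⟩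
      · rcases h3 L N hN with h' | ⟨rfl, rfl⟩
        · exact Or.inl ⟨N, h'⟩
        · exact Or.inl ⟨H, h1⟩
      · rcases h3 N L hN with h' | ⟨rfl, rfl⟩
        · exact Or.inr ⟨N, h'⟩
        · exact Or.inr ⟨H, h2⟩
  · intro v hv
    suffices ∃ L N, IsSucc (Insert.insert H 𝓕) L N ∧ v ∈ N ∧ v ∉ L by
      obtain ⟨L, N, hLN, hvN, hvL⟩ := this
      refine ⟨L, ⟨N, hLN, hvN, hvL⟩, ?_⟩
      rintro L' ⟨N', hLN', hvN', hvL'⟩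
      exact step_unique hchain hLN' hLN hvN' hvL' hvN hvL
    obtain ⟨L, ⟨N, hLN, hvN, hvL⟩, -⟩ := hF.unique_step v hv
    rcases h3 L N hLN with h' | ⟨rfl, rfl⟩
    · exact ⟨L, N, h', hvN, hvL⟩
    · by_cases hvH : v ∈ H
      · exact ⟨L, H, h1, hvH, hvL⟩
      · exact ⟨H, N, h2, hvN, hvH⟩

theorem basis_mem_span_iff (E : Module.Basis ℕ+ ℂ V) (s : Set ℕ+) (q : ℕ+) :
    E q ∈ Submodule.span ℂ (E '' s) ↔ q ∈ s := by
  rw [E.mem_span_image]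
  simp

theorem mem_span_basis_iff (E : Module.Basis ℕ+ ℂ V) (s : Set ℕ+) (x : V) :
    x ∈ Submodule.span ℂ (E '' s) ↔ ∀ ℓ, E.repr x ℓ ≠ 0 → ℓ ∈ s := by
  rw [E.mem_span_image]
  simp [Set.subset_def]

theorem isSucc_flagOf {A : Type} [LinearOrder A] (σ : ℕ+ → A) (E : Module.Basis ℕ+ ℂ V) (p : ℕ+) :
    IsSucc (flagOf σ E) (Submodule.span ℂ (E '' {ℓ | σ ℓ < σ p}))
      (Submodule.span ℂ (E '' {ℓ | σ ℓ ≤ σ p})) := by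
  refine ⟨⟨σ p, Or.inl rfl⟩, ⟨σ p, Or.inr rfl⟩, ?_, ?_⟩
  · refine lt_of_le_of_ne (Submodule.span_mono (Set.image_mono fun ℓ (h : σ ℓ < σ p) => h.le)) ?_
    intro h
    have := (basis_mem_span_iff E {ℓ | σ ℓ ≤ σ p} p).2 (le_refl (σ p))
    rw [← h, basis_mem_span_iff] at this
    exact lt_irrefl _ this
  · rintro L ⟨b, hb⟩ ⟨h1, h2⟩
    rcases lt_trichotomy b (σ p) with hlt | rfl | hgt
    · refine h1.not_ge ?_
      rcases hb with rfl | rfl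
      · exact Submodule.span_mono (Set.image_mono fun ℓ (h : σ ℓ < b) => h.trans hlt)
      · exact Submodule.span_mono (Set.image_mono fun ℓ (h : σ ℓ ≤ b) => h.trans_lt hlt)
    · rcases hb with rfl | rfl
      · exact lt_irrefl _ h1
      · exact lt_irrefl _ h2
    · refine h2.not_ge ?_
      rcases hb with rfl | rfl
      · exact Submodule.span_mono (Set.image_mono fun ℓ (h : σ ℓ ≤ σ p) => h.trans_lt hgt)
      · exact Submodule.span_mono (Set.image_mono fun ℓ (h : σ ℓ ≤ σ p) => h.trans hgt.le)

/-- The steps of a maximal generalized flag have dimension one. -/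
theorem injective_of_isMaximal {A : Type} [LinearOrder A] {σ : ℕ+ → A} {E : Module.Basis ℕ+ ℂ V}
    (h : IsMaximalGeneralizedFlag (flagOf σ E)) : Function.Injective σ := by
  intro p q hpq
  by_contra hne
  have hs := isSucc_flagOf σ E p
  -- Adding `e_p` alone to the lower member lands strictly inside the step, since `e_q` is left out;
  -- this contradicts maximality.
  set H := Submodule.span ℂ (E '' {ℓ | σ ℓ < σ p ∨ ℓ = p}) with hH
  have h1 : Submodule.span ℂ (E '' {ℓ | σ ℓ < σ p}) < H := by
    refine lt_of_le_of_ne (Submodule.span_mono (Set.image_mono fun ℓ h => Or.inl h)) fun he => ?_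
    have : E p ∈ H := (basis_mem_span_iff E _ p).2 (Or.inr rfl)
    rw [← he, basis_mem_span_iff] at this
    exact lt_irrefl _ this
  have h2 : H < Submodule.span ℂ (E '' {ℓ | σ ℓ ≤ σ p}) := by
    refine lt_of_le_of_ne (Submodule.span_mono (Set.image_mono ?_)) fun he => ?_
    · rintro ℓ (h | rfl)
      · exact le_of_lt h
      · exact le_refl (σ ℓ)
    · have : E q ∈ H := by
        rw [he]
        exact (basis_mem_span_iff E _ q).2 hpq.ge
      rw [hH, basis_mem_span_iff] at this
      rcases this with h | h
      · exact lt_irrefl _ (hpq ▸ h)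
      · exact hne h.symm
  have := h.2 _ (h.1.insert hs h1 h2) (Set.subset_insert _ _)
  have hmem : H ∈ flagOf σ E := this ▸ Set.mem_insert _ _
  exact hs.2.2.2 H hmem ⟨h1, h2⟩

theorem omegaForm_basis (E : Module.Basis ℕ+ ℂ V) (c : ℂ) (ι : ℕ+ → ℕ+) (i j : ℕ+) :
    omegaForm E c ι (E i) (E j) = Omega c ι i j := by
  simp [omegaForm]

/-- If `𝓕` is isotropic then `Ω` has at most one block of size one. -/
theorem fixed_unique_of_isIsotropic {A : Type} [LinearOrder A] {σ : ℕ+ → A}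
    {E : Module.Basis ℕ+ ℂ V} (hσ : Function.Injective σ) {c : ℂ} {ι : ℕ+ → ℕ+}
    (h : IsIsotropicFlag (omegaForm E c ι) (flagOf σ E)) {p q : ℕ+}
    (hp : ι p = p) (hq : ι q = q) : p = q := by
  have key : ∀ p q, ι p = p → ι q = q → ¬ σ p < σ q := by
    intro p q hp hq hlt
    -- The orthogonal of this member contains `e_q` but not `e_p`, whereas members of the flag are
    -- spanned by initial segments for `σ` and `σ p < σ q`.
    obtain ⟨⟨b, hb⟩, -⟩ := h (Submodule.span ℂ (E '' {ℓ | σ ℓ ≤ σ p})) ⟨σ p, Or.inr rfl⟩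
    have hEp : E p ∉ perp (omegaForm E c ι) (Submodule.span ℂ (E '' {ℓ | σ ℓ ≤ σ p})) := by
      intro hm
      have := hm (E p) ((basis_mem_span_iff E _ p).2 (le_refl (σ p)))
      rw [omegaForm_basis] at this
      simp [Omega, hp] at this
    have hEq : E q ∈ perp (omegaForm E c ι) (Submodule.span ℂ (E '' {ℓ | σ ℓ ≤ σ p})) := by
      intro y hy
      induction hy using Submodule.span_induction with
      | mem y hy =>
        obtain ⟨ℓ, hℓ, rfl⟩ := hy
        rw [omegaForm_basis, Omega, hq, if_neg]
        rintro rfl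
        exact hlt.not_ge hℓ
      | zero => simp
      | add y z _ _ hy hz => simp [hy, hz]
      | smul a y _ hy => simp [hy]
    rcases hb with hb | hb <;> rw [hb, basis_mem_span_iff] at hEp hEq
    · exact hEp (hlt.trans hEq)
    · exact hEp (hlt.le.trans hEq)
  rcases lt_trichotomy (σ p) (σ q) with h' | h' | h'
  · exact absurd h' (key p q hp hq)
  · exact hσ h'
  · exact absurd h' (key q p hq hp)

end Chains

/-! ### Finitary stabilizers of a flag are triangular. -/

section Triangular

variable {V : Type*} [AddCommGroup V] [Module ℂ V]

theorem finiteDimensional_span_basis_Iio (E : Module.Basis ℕ+ ℂ V) (n : ℕ+) :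
    FiniteDimensional ℂ (Submodule.span ℂ (E '' Set.Iio n)) :=
  FiniteDimensional.span_of_finite ℂ ((Set.finite_Iio n).image E)

/-- A finitary automorphism stabilizes the span of a large enough initial segment of the basis. -/
theorem exists_forall_mem_span_of_mem_GLinf (E : Module.Basis ℕ+ ℂ V) {u : V ≃ₗ[ℂ] V}
    (hu : u ∈ GLinf E) (x : V) : ∃ n : ℕ+, x ∈ Submodule.span ℂ (E '' Set.Iio n) ∧
      ∀ y ∈ Submodule.span ℂ (E '' Set.Iio n), u y ∈ Submodule.span ℂ (E '' Set.Iio n) := by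
  obtain ⟨m, hm⟩ := Filter.eventually_atTop.1 hu
  -- Beyond `m` the basis is fixed, so a cutoff past `m`, the support of `x` and the supports of the
  -- finitely many `u e_ℓ` with `ℓ < m` gives a stable span.
  set S : Finset ℕ+ := (E.repr x).support ∪ (Finset.Iio m).biUnion fun ℓ => (E.repr (u (E ℓ))).support
  obtain ⟨k, hk⟩ := S.bddAbove
  have hlt : ∀ ℓ ∈ S, ℓ < max m (k + 1) := fun ℓ hℓ =>
    lt_of_lt_of_le (PNat.lt_add_one_iff.2 (hk hℓ)) (le_max_right _ _)
  refine ⟨max m (k + 1), ?_, ?_⟩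
  · rw [mem_span_basis_iff]
    intro ℓ hℓ
    exact hlt ℓ (Finset.mem_union_left _ (Finsupp.mem_support_iff.2 hℓ))
  · intro y hy
    induction hy using Submodule.span_induction with
    | mem y hy =>
      obtain ⟨ℓ, hℓ, rfl⟩ := hy
      by_cases h : m ≤ ℓ
      · rw [hm ℓ h]
        exact Submodule.subset_span ⟨ℓ, hℓ, rfl⟩
      · rw [mem_span_basis_iff]
        intro j hj
        refine hlt j (Finset.mem_union_right _ (Finset.mem_biUnion.2 ⟨ℓ, ?_, ?_⟩))
        · exact Finset.mem_Iio.2 (not_le.1 h)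
        · exact Finsupp.mem_support_iff.2 hj
    | zero => simp
    | add y z _ _ hy hz => simpa using Submodule.add_mem _ hy hz
    | smul a y _ hy => simpa using Submodule.smul_mem _ a hy

theorem mem_smul_iff_symm (u : V ≃ₗ[ℂ] V) (F : Submodule ℂ V) (x : V) :
    x ∈ u • F ↔ u⁻¹ x ∈ F := by
  rw [Submodule.mem_smul_pointwise_iff_exists]
  constructor
  · rintro ⟨y, hy, rfl⟩
    rw [LinearEquiv.smul_def]
    simpa using hy
  · intro h
    exact ⟨_, h, by rw [LinearEquiv.smul_def]; exact u.apply_symm_apply x⟩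

theorem smul_mem_smul_flag (u : V ≃ₗ[ℂ] V) {F : Submodule ℂ V} {x : V} (hx : x ∈ F) :
    u x ∈ u • F := by
  rw [mem_smul_iff_symm]
  simpa using hx

/-- In infinite dimension such an inclusion could be strict for a general automorphism. A finitary
one allows a dimension count: any `x ∈ u • F` lies in a finite-dimensional `W` stable under `u⁻¹`,
and `u⁻¹` embeds `(u • F) ⊓ W` into `F ⊓ W`. -/
theorem eq_smul_of_le_smul (E : Module.Basis ℕ+ ℂ V) {u : V ≃ₗ[ℂ] V} (hu : u ∈ GLinf E)
    {F : Submodule ℂ V} (h : F ≤ u • F) : u • F = F := by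
  refine le_antisymm (fun x hx => ?_) h
  obtain ⟨n, hxn, hn⟩ := exists_forall_mem_span_of_mem_GLinf E ((GLinf E).inv_mem hu) x
  have := finiteDimensional_span_basis_Iio E n
  set W := Submodule.span ℂ (E '' Set.Iio n)
  have hle : F ⊓ W ≤ (u • F) ⊓ W := inf_le_inf_right W h
  have hmaps : ∀ y ∈ (u • F) ⊓ W, (u⁻¹ : V ≃ₗ[ℂ] V) y ∈ F ⊓ W := fun y hy =>
    ⟨(mem_smul_iff_symm u F y).1 hy.1, hn y hy.2⟩
  have : FiniteDimensional ℂ ↥(F ⊓ W) := Submodule.finiteDimensional_inf_right F W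
  have : FiniteDimensional ℂ ↥((u • F) ⊓ W) := Submodule.finiteDimensional_inf_right _ W
  have hrank : Module.finrank ℂ ↥((u • F) ⊓ W) ≤ Module.finrank ℂ ↥(F ⊓ W) := by
    refine LinearMap.finrank_le_finrank_of_injective
      (f := ((u⁻¹ : V ≃ₗ[ℂ] V) : V →ₗ[ℂ] V).restrict hmaps) fun a b hab => ?_
    have := congrArg Subtype.val hab
    exact Subtype.ext ((u⁻¹ : V ≃ₗ[ℂ] V).injective this)
  have heq := Submodule.eq_of_le_of_finrank_le hle hrank
  have hx' : x ∈ F ⊓ W := heq ▸ ⟨hx, hxn⟩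
  exact hx'.1

/-- A finitary automorphism that maps a chain to itself stabilizes all its members. -/
theorem smul_eq_of_smul_mem_chain (E : Module.Basis ℕ+ ℂ V) {𝓕 : Set (Submodule ℂ V)}
    (hc : IsChain (· ≤ ·) 𝓕) {u : V ≃ₗ[ℂ] V} (hu : u ∈ GLinf E) (h : u • 𝓕 = 𝓕)
    {F : Submodule ℂ V} (hF : F ∈ 𝓕) : u • F = F := by
  have huF : u • F ∈ 𝓕 := h ▸ Set.smul_mem_smul_set hF
  rcases hc.total hF huF with h' | h'
  · exact eq_smul_of_le_smul E hu h'
  · have : u⁻¹ • F = F := by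
      refine eq_smul_of_le_smul E ((GLinf E).inv_mem hu) fun x hx => ?_
      rw [mem_smul_iff_symm, inv_inv]
      exact h' (smul_mem_smul_flag u hx)
    exact (inv_smul_eq_iff.1 this).symm

/-- Two cosets in the same orbit differ by an element stabilizing all members of the flag. -/
theorem smul_eq_of_orbit_eq (E : Module.Basis ℕ+ ℂ V) {𝓕 : Set (Submodule ℂ V)}
    (hc : IsChain (· ≤ ·) 𝓕) {G H : Subgroup (V ≃ₗ[ℂ] V)} (hG : G ≤ GLinf E) (g₁ g₂ : G)
    (h : (Quotient.mk'' (g₁ : G ⧸ (flagStabilizer 𝓕).subgroupOf G) : OrbitSet G H 𝓕) =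
      Quotient.mk'' (g₂ : G ⧸ (flagStabilizer 𝓕).subgroupOf G)) :
    ∃ k ∈ H, ∀ F ∈ 𝓕, ((g₂ : V ≃ₗ[ℂ] V)⁻¹ * k * g₁) • F = F := by
  rw [Quotient.eq'', MulAction.orbitRel_apply] at h
  obtain ⟨k, hk⟩ := h
  have hk' : ((k : G) * g₂ : G) = ((g₁ : G) : G ⧸ (flagStabilizer 𝓕).subgroupOf G) := hk
  rw [QuotientGroup.eq, Subgroup.mem_subgroupOf] at hk'
  have hk₀ : ((k : G) : V ≃ₗ[ℂ] V) ∈ H := Subgroup.mem_subgroupOf.1 k.2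
  refine ⟨((k : G) : V ≃ₗ[ℂ] V)⁻¹, H.inv_mem hk₀, fun F hF => ?_⟩
  have hst : ((g₂ : V ≃ₗ[ℂ] V)⁻¹ * ((k : G) : V ≃ₗ[ℂ] V)⁻¹ * g₁) • 𝓕 = 𝓕 := by
    have := MulAction.mem_stabilizer_iff.1 hk'
    simpa using this
  refine smul_eq_of_smul_mem_chain E hc (hG ?_) hst hF
  exact G.mul_mem (G.mul_mem (G.inv_mem g₂.2) (G.inv_mem (k : G).2)) g₁.2

/-- Infinitely many elements of `G`, separated by an invariant of the orbits of `H`, give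
infinitely many orbits. -/
theorem infinite_orbitSet_of_separates (E : Module.Basis ℕ+ ℂ V) {𝓕 : Set (Submodule ℂ V)}
    (hc : IsChain (· ≤ ·) 𝓕) {G H : Subgroup (V ≃ₗ[ℂ] V)} (hG : G ≤ GLinf E) {α : Type*}
    {W : Set α} (hW : W.Infinite) (M : (V ≃ₗ[ℂ] V) → α → Prop) (hM : ∀ w ∈ W, ∃ g ∈ G, M g w)
    (hsep : ∀ k ∈ H, ∀ g₁ w₁ g₂ w₂, M g₁ w₁ → M g₂ w₂ →
      (∀ F ∈ 𝓕, (g₂⁻¹ * k * g₁) • F = F) → w₁ = w₂) :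
    Infinite (OrbitSet G H 𝓕) := by
  have := hW.to_subtype
  choose g hg hgM using fun w : W => hM w w.2
  refine Infinite.of_injective (fun w : W =>
    (Quotient.mk'' (⟨g w, hg w⟩ : G) : OrbitSet G H 𝓕)) fun w₁ w₂ h => ?_
  obtain ⟨k, hk, hF⟩ := smul_eq_of_orbit_eq E hc hG _ _ h
  exact Subtype.ext (hsep k hk _ _ _ _ (hgM w₁) (hgM w₂) hF)

section

variable {A : Type} [LinearOrder A] {σ : ℕ+ → A} {E : Module.Basis ℕ+ ℂ V} {u : V ≃ₗ[ℂ] V}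

theorem le_of_repr_ne_zero (hu : ∀ F ∈ flagOf σ E, u • F = F) {ℓ m : ℕ+}
    (h : E.repr (u (E m)) ℓ ≠ 0) : σ ℓ ≤ σ m := by
  have h1 : u (E m) ∈ u • Submodule.span ℂ (E '' {ℓ | σ ℓ ≤ σ m}) :=
    smul_mem_smul_flag u ((basis_mem_span_iff E _ m).2 (le_refl (σ m)))
  rw [hu _ ⟨σ m, Or.inr rfl⟩, mem_span_basis_iff] at h1
  exact h1 ℓ h

/-- Were the diagonal entry zero, `u e_m` would lie in the member spanned by the strictly smaller
basis vectors; `u⁻¹` preserves that member, so it would contain `e_m`. -/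
theorem repr_diag_ne_zero (hσ : Function.Injective σ) (hu : ∀ F ∈ flagOf σ E, u • F = F) (m : ℕ+) :
    E.repr (u (E m)) m ≠ 0 := by
  intro h
  have h1 : u (E m) ∈ u • Submodule.span ℂ (E '' {ℓ | σ ℓ < σ m}) := by
    rw [hu _ ⟨σ m, Or.inl rfl⟩, mem_span_basis_iff]
    intro ℓ hℓ
    refine lt_of_le_of_ne (le_of_repr_ne_zero hu hℓ) fun he => hℓ ?_
    rw [hσ he, h]
  rw [mem_smul_iff_symm] at h1
  have h2 : E m ∈ Submodule.span ℂ (E '' {ℓ | σ ℓ < σ m}) := by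
    rwa [← LinearEquiv.mul_apply, inv_mul_cancel] at h1
  rw [basis_mem_span_iff] at h2
  exact lt_irrefl _ h2

end

end Triangular

/-! ### The standard Hermitian form. -/

section Hermitian

variable {V : Type*} [AddCommGroup V] [Module ℂ V]

open ComplexConjugate

/-- The standard Hermitian form attached to a basis, antilinear in the first variable. -/
noncomputable def herm (E : Module.Basis ℕ+ ℂ V) : V →ₗ⋆[ℂ] V →ₗ[ℂ] ℂ :=
  LinearMap.mk₂'ₛₗ (starRingEnd ℂ) (RingHom.id ℂ)
    (fun x y => (E.repr x).sum fun ℓ a => conj a * E.repr y ℓ)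
    (fun x x' y => by
      rw [map_add, Finsupp.sum_add_index'] <;> simp [add_mul])
    (fun a x y => by
      rw [map_smul, Finsupp.sum_smul_index' (by simp), smul_eq_mul, Finsupp.mul_sum]
      simp [mul_assoc])
    (fun x y y' => by
      simp [mul_add])
    (fun a x y => by
      rw [RingHom.id_apply, smul_eq_mul, Finsupp.mul_sum]
      simp [mul_left_comm])

theorem herm_apply (E : Module.Basis ℕ+ ℂ V) (x y : V) :
    herm E x y = (E.repr x).sum fun ℓ a => conj a * E.repr y ℓ := rfl

@[simp]
theorem herm_basis_left (E : Module.Basis ℕ+ ℂ V) (ℓ : ℕ+) (y : V) :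
    herm E (E ℓ) y = E.repr y ℓ := by
  simp [herm_apply]

theorem conj_herm (E : Module.Basis ℕ+ ℂ V) (x y : V) : conj (herm E x y) = herm E y x := by
  rw [herm_apply, herm_apply,
    Finsupp.sum_of_support_subset _ (Finset.subset_union_left (s₂ := (E.repr y).support)) _ (by simp),
    Finsupp.sum_of_support_subset _ (Finset.subset_union_right (s₁ := (E.repr x).support)) _ (by simp)]
  simp [mul_comm]

theorem herm_basis_right (E : Module.Basis ℕ+ ℂ V) (ℓ : ℕ+) (x : V) :
    herm E x (E ℓ) = conj (E.repr x ℓ) := by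
  rw [← conj_herm, herm_basis_left]

/-- The unitary elements for the standard Hermitian form. -/
noncomputable abbrev unitaryGroup (E : Module.Basis ℕ+ ℂ V) : Subgroup (V ≃ₗ[ℂ] V) :=
  preserving fun x y => herm E x y

end Hermitian

/-! ### The permutation as an invariant of orbits. -/

section Separation

variable {V : Type*} [AddCommGroup V] [Module ℂ V] {θ : ℂ →+* ℂ}

open ComplexConjugate

/-- `f` permutes, up to scalars, the lines spanned by the vectors `g e_ℓ`, according to `w`. -/
def IsMonomialAt (E : Module.Basis ℕ+ ℂ V) (f : V → V) (g : V ≃ₗ[ℂ] V)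
    (w : Equiv.Perm ℕ+) : Prop :=
  ∀ ℓ, ∃ c : ℂ, c ≠ 0 ∧ f (g (E ℓ)) = c • g (E (w ℓ))

/-- In the basis `g e_ℓ` the map `f` has a monomial matrix, and `w` is injective, so the coordinate
at `w m` of an image sees only the coordinate at `m`. -/
theorem IsMonomialAt.repr_eq {E : Module.Basis ℕ+ ℂ V} {f : V →ₛₗ[θ] V} {g : V ≃ₗ[ℂ] V}
    {w : Equiv.Perm ℕ+} (h : IsMonomialAt E f g w) (m : ℕ+) :
    ∃ c : ℂ, c ≠ 0 ∧ ∀ x, E.repr (g⁻¹ (f (g x))) (w m) = c * θ (E.repr x m) := by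
  obtain ⟨c, hc, hcm⟩ := h m
  refine ⟨c, hc, fun x => ?_⟩
  have hx : x ∈ Submodule.span ℂ (Set.range E) := E.mem_span x
  induction hx using Submodule.span_induction with
  | mem x hx =>
    obtain ⟨ℓ, rfl⟩ := hx
    obtain ⟨d, -, hdm⟩ := h ℓ
    by_cases hℓ : ℓ = m
    · subst hℓ
      rw [hcm, map_smul]
      simp
    · rw [hdm, map_smul]
      simp [hℓ]
  | zero => simp
  | add x y _ _ hx hy => rw [map_add, map_add, map_add, map_add, Finsupp.add_apply, hx, hy,
      map_add, Finsupp.add_apply, map_add, mul_add]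
  | smul a x _ hx => rw [map_smul, map_smulₛₗ, map_smul, map_smul, Finsupp.smul_apply, hx,
      map_smul, Finsupp.smul_apply, smul_eq_mul, smul_eq_mul, map_mul, mul_left_comm]

theorem IsMonomialAt.repr_ne_zero {E : Module.Basis ℕ+ ℂ V} {f : V →ₛₗ[θ] V} {g : V ≃ₗ[ℂ] V}
    {w : Equiv.Perm ℕ+} (h : IsMonomialAt E f g w) {m : ℕ+} {x : V} (hx : E.repr x m ≠ 0) :
    E.repr (g⁻¹ (f (g x))) (w m) ≠ 0 := by
  obtain ⟨c, hc, hcx⟩ := h.repr_eq m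
  rw [hcx]
  exact mul_ne_zero hc ((map_ne_zero θ).2 hx)

variable {A : Type} [LinearOrder A] {σ : ℕ+ → A} {E : Module.Basis ℕ+ ℂ V}

theorem perm_eq_of_forall_le (hσ : Function.Injective σ) {w₁ w₂ : Equiv.Perm ℕ+}
    (h : ∀ m, σ (w₁ m) ≤ σ (w₂ m)) (h' : ∀ m, σ (w₂ m) ≤ σ (w₁ m)) : w₁ = w₂ :=
  Equiv.ext fun m => hσ (le_antisymm (h m) (h' m))

theorem inv_smul_eq_of_smul_eq {g₁ g₂ k : V ≃ₗ[ℂ] V} {𝓕 : Set (Submodule ℂ V)}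
    (h : ∀ F ∈ 𝓕, (g₂⁻¹ * k * g₁) • F = F) : ∀ F ∈ 𝓕, (g₁⁻¹ * k⁻¹ * g₂) • F = F := by
  intro F hF
  have := h F hF
  rw [eq_comm, ← inv_smul_eq_iff] at this
  simpa [mul_assoc] using this

/-- With `Fᵢ = gᵢ⁻¹ f gᵢ` and `u = g₂⁻¹ k g₁`, commutation gives `F₂ u = u F₁`. Applied to `e_m`,
the left side has a nonzero coordinate at `w₂ m`, because `u` has nonzero diagonal, while the right
side is a multiple of `u e_{w₁ m}`; triangularity compares the two indices. -/
theorem le_of_commuting (hσ : Function.Injective σ) {f : V →ₛₗ[θ] V} {k g₁ g₂ : V ≃ₗ[ℂ] V}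
    {w₁ w₂ : Equiv.Perm ℕ+} (hk : k ∈ commuting f) (h₁ : IsMonomialAt E f g₁ w₁)
    (h₂ : IsMonomialAt E f g₂ w₂) (hu : ∀ F ∈ flagOf σ E, (g₂⁻¹ * k * g₁) • F = F) (m : ℕ+) :
    σ (w₂ m) ≤ σ (w₁ m) := by
  have h := h₂.repr_ne_zero (repr_diag_ne_zero hσ hu m)
  obtain ⟨c, hc, hcm⟩ := h₁ m
  have e : (g₂⁻¹ : V ≃ₗ[ℂ] V) (f (g₂ ((g₂⁻¹ * k * g₁) (E m)))) =
      c • (g₂⁻¹ * k * g₁) (E (w₁ m)) := by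
    have e1 : g₂ ((g₂⁻¹ * k * g₁) (E m)) = k (g₁ (E m)) := by
      simp [LinearEquiv.mul_apply]
    rw [e1, hk, hcm]
    simp [LinearEquiv.mul_apply]
  rw [e, map_smul, Finsupp.smul_apply, smul_eq_mul] at h
  exact le_of_repr_ne_zero hu (right_ne_zero_of_mul h)

theorem perm_eq_of_commuting (hσ : Function.Injective σ) {f : V →ₛₗ[θ] V} {k g₁ g₂ : V ≃ₗ[ℂ] V}
    {w₁ w₂ : Equiv.Perm ℕ+} (hk : k ∈ commuting f) (h₁ : IsMonomialAt E f g₁ w₁)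
    (h₂ : IsMonomialAt E f g₂ w₂) (hu : ∀ F ∈ flagOf σ E, (g₂⁻¹ * k * g₁) • F = F) : w₁ = w₂ :=
  perm_eq_of_forall_le hσ
    (le_of_commuting hσ ((commuting f).inv_mem hk) h₂ h₁ (inv_smul_eq_of_smul_eq hu))
    (le_of_commuting hσ hk h₁ h₂ hu)

/-- Here `k` need not commute with `f`, so the nonzero coordinate at `w₂ m` is written as a
Hermitian product and moved back through `k`. Unitarity of `g₁` and `g₂` turns it, up to conjugation
and a nonzero factor, into the coordinate at `w₁ m` of `u⁻¹ e_{w₂ m}`. The triangular map is now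
`u⁻¹`, so the inequality is opposite to that of `le_of_commuting`. -/
theorem le_of_preserving (hσ : Function.Injective σ) {f : V →ₛₗ[θ] V} {k g₁ g₂ : V ≃ₗ[ℂ] V}
    {w₁ w₂ : Equiv.Perm ℕ+} (hk : k ∈ preserving fun x y => herm E (f x) y)
    (hg₁ : g₁ ∈ unitaryGroup E) (hg₂ : g₂ ∈ unitaryGroup E)
    (h₁ : IsMonomialAt E f g₁ w₁) (h₂ : IsMonomialAt E f g₂ w₂)
    (hu : ∀ F ∈ flagOf σ E, (g₂⁻¹ * k * g₁) • F = F) (m : ℕ+) : σ (w₁ m) ≤ σ (w₂ m) := by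
  have h := h₂.repr_ne_zero (repr_diag_ne_zero hσ hu m)
  obtain ⟨c, hc, hcm⟩ := h₁ m
  have hk' : ∀ x y, herm E (f (k x)) (k y) = herm E (f x) y := hk
  have hg₁' : ∀ x y, herm E (g₁ x) (g₁ y) = herm E x y := hg₁
  have hg₂' : ∀ x y, herm E (g₂ x) (g₂ y) = herm E x y := hg₂
  set v := (g₁⁻¹ * k⁻¹ * g₂) (E (w₂ m)) with hv
  have e1 : g₂ ((g₂⁻¹ * k * g₁) (E m)) = k (g₁ (E m)) := by
    simp [LinearEquiv.mul_apply]
  have e2 : g₂ (E (w₂ m)) = k (g₁ v) := by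
    simp [hv, LinearEquiv.mul_apply]
  have e3 : conj (E.repr ((g₂⁻¹ : V ≃ₗ[ℂ] V) (f (g₂ ((g₂⁻¹ * k * g₁) (E m))))) (w₂ m)) =
      conj c * E.repr v (w₁ m) := by
    rw [← herm_basis_right, ← hg₂' _ (E (w₂ m)), e1, e2]
    have e4 : g₂ ((g₂⁻¹ : V ≃ₗ[ℂ] V) (f (k (g₁ (E m))))) = f (k (g₁ (E m))) := by
      simp
    rw [e4, hk', hcm, ← map_smul, hg₁']
    simp
  refine le_of_repr_ne_zero (inv_smul_eq_of_smul_eq hu) (ℓ := w₁ m) (m := w₂ m) fun h0 => h ?_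
  rw [← hv] at h0
  rw [h0, mul_zero] at e3
  exact (map_eq_zero _).1 e3

theorem perm_eq_of_preserving (hσ : Function.Injective σ) {f : V →ₛₗ[θ] V} {k g₁ g₂ : V ≃ₗ[ℂ] V}
    {w₁ w₂ : Equiv.Perm ℕ+} (hk : k ∈ preserving fun x y => herm E (f x) y)
    (hg₁ : g₁ ∈ unitaryGroup E) (hg₂ : g₂ ∈ unitaryGroup E)
    (h₁ : IsMonomialAt E f g₁ w₁) (h₂ : IsMonomialAt E f g₂ w₂)
    (hu : ∀ F ∈ flagOf σ E, (g₂⁻¹ * k * g₁) • F = F) : w₁ = w₂ :=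
  perm_eq_of_forall_le hσ (le_of_preserving hσ hk hg₁ hg₂ h₁ h₂ hu)
    (le_of_preserving hσ ((preserving _).inv_mem hk) hg₂ hg₁ h₂ h₁ (inv_smul_eq_of_smul_eq hu))

/-- The common criterion for a subgroup commuting with `f` and a subgroup preserving the form
`(x, y) ↦ ⟨f x, y⟩`. -/
theorem infinite_orbitSets (hσ : Function.Injective σ) (hc : IsChain (· ≤ ·) (flagOf σ E))
    (f : V →ₛₗ[θ] V) {G H₁ H₂ : Subgroup (V ≃ₗ[ℂ] V)} (hG : G ≤ GLinf E)
    (hH₁ : H₁ ≤ commuting f) (hH₂ : H₂ ≤ preserving fun x y => herm E (f x) y)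
    {W : Set (Equiv.Perm ℕ+)} (hW : W.Infinite)
    (hM : ∀ w ∈ W, ∃ g ∈ G, g ∈ unitaryGroup E ∧ IsMonomialAt E f g w) :
    Infinite (OrbitSet G H₁ (flagOf σ E)) ∧ Infinite (OrbitSet G H₂ (flagOf σ E)) := by
  constructor
  · refine infinite_orbitSet_of_separates E hc hG hW
      (fun g w => g ∈ unitaryGroup E ∧ IsMonomialAt E f g w) hM ?_
    exact fun k hk g₁ w₁ g₂ w₂ h₁ h₂ hu => perm_eq_of_commuting hσ (hH₁ hk) h₁.2 h₂.2 hu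
  · refine infinite_orbitSet_of_separates E hc hG hW
      (fun g w => g ∈ unitaryGroup E ∧ IsMonomialAt E f g w) hM ?_
    exact fun k hk g₁ w₁ g₂ w₂ h₁ h₂ hu =>
      perm_eq_of_preserving hσ (hH₂ hk) h₁.1 h₂.1 h₁.2 h₂.2 hu

end Separation

/-! ### The maps `γ` and `δ`, and their relation to `ω` and `φ`. -/

section Structures

variable {V : Type*} [AddCommGroup V] [Module ℂ V]

open ComplexConjugate

/-- The map `γ` as an antilinear map. -/
noncomputable def gammaHom (E : Module.Basis ℕ+ ℂ V) (c : ℂ) (ι : ℕ+ → ℕ+) : V →ₗ⋆[ℂ] V where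
  toFun := gammaMap E c ι
  map_add' x y := by
    rw [gammaMap, map_add, Finsupp.sum_add_index'] <;> simp [gammaMap, mul_add, add_smul]
  map_smul' a x := by
    rw [gammaMap, map_smul, Finsupp.sum_smul_index' (by simp), gammaMap, Finsupp.smul_sum]
    simp [smul_smul, mul_left_comm]

theorem coe_gammaHom (E : Module.Basis ℕ+ ℂ V) (c : ℂ) (ι : ℕ+ → ℕ+) :
    ⇑(gammaHom E c ι) = gammaMap E c ι := rfl

/-- The nonzero entry of column `j` of `Ω`. -/
noncomputable def gammaCoeff (c : ℂ) (ι : ℕ+ → ℕ+) (j : ℕ+) : ℂ := if ι j ≤ j then 1 else c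

theorem Omega_involution {c : ℂ} {ι : ℕ+ → ℕ+} (hι : Function.Involutive ι) (j : ℕ+) :
    Omega c ι (ι j) j = gammaCoeff c ι j := by
  simp [Omega, hι j, gammaCoeff]

theorem gammaHom_basis (E : Module.Basis ℕ+ ℂ V) {c : ℂ} {ι : ℕ+ → ℕ+}
    (hι : Function.Involutive ι) (j : ℕ+) :
    gammaHom E c ι (E j) = gammaCoeff c ι j • E (ι j) := by
  simp [coe_gammaHom, gammaMap, Omega_involution hι]

theorem gammaCoeff_eq {c : ℂ} (hc : c = 1 ∨ c = -1) (ι : ℕ+ → ℕ+) (j : ℕ+) :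
    gammaCoeff c ι j = 1 ∨ gammaCoeff c ι j = -1 := by
  unfold gammaCoeff
  split_ifs
  · exact Or.inl rfl
  · exact hc

theorem conj_mul_self_gammaCoeff {c : ℂ} (hc : c = 1 ∨ c = -1) (ι : ℕ+ → ℕ+) (j : ℕ+) :
    conj (gammaCoeff c ι j) * gammaCoeff c ι j = 1 := by
  rcases gammaCoeff_eq hc ι j with h | h <;> simp [h]

theorem conj_gammaCoeff {c : ℂ} (hc : c = 1 ∨ c = -1) (ι : ℕ+ → ℕ+) (j : ℕ+) :
    conj (gammaCoeff c ι j) = gammaCoeff c ι j := by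
  rcases gammaCoeff_eq hc ι j with h | h <;> simp [h]

theorem gammaCoeff_ne_zero {c : ℂ} (hc : c = 1 ∨ c = -1) (ι : ℕ+ → ℕ+) (j : ℕ+) :
    gammaCoeff c ι j ≠ 0 := by
  rcases gammaCoeff_eq hc ι j with h | h <;> simp [h]

/-- This says that `γ²` is multiplication by `c` on the blocks of size two. -/
theorem gammaCoeff_mul {c : ℂ} {ι : ℕ+ → ℕ+} (hι : Function.Involutive ι) {j : ℕ+}
    (hj : ι j ≠ j) : gammaCoeff c ι j * gammaCoeff c ι (ι j) = c := by
  unfold gammaCoeff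
  rw [hι j]
  rcases lt_or_gt_of_ne hj with h | h
  · rw [if_pos h.le, if_neg h.not_ge, one_mul]
  · rw [if_neg h.not_ge, if_pos h.le, mul_one]

theorem gammaHom_repr (E : Module.Basis ℕ+ ℂ V) {c : ℂ} {ι : ℕ+ → ℕ+}
    (hι : Function.Involutive ι) (x : V) (j : ℕ+) :
    E.repr (gammaHom E c ι x) (ι j) = gammaCoeff c ι j * conj (E.repr x j) := by
  induction E.mem_span x using Submodule.span_induction with
  | mem x hx =>
    obtain ⟨ℓ, rfl⟩ := hx
    rw [gammaHom_basis E hι]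
    by_cases h : ℓ = j
    · subst h
      simp
    · simp [h, hι.injective.ne h]
  | zero => simp
  | add x y _ _ hx hy => simp [hx, hy, mul_add]
  | smul a x _ hx => simp [hx, mul_left_comm]

/-- `ω(y, x) = ⟨γ x, y⟩`. -/
theorem omegaForm_eq_herm (E : Module.Basis ℕ+ ℂ V) {c : ℂ} (hc : c = 1 ∨ c = -1) {ι : ℕ+ → ℕ+}
    (hι : Function.Involutive ι) (x y : V) :
    omegaForm E c ι y x = herm E (gammaHom E c ι x) y := by
  induction E.mem_span x using Submodule.span_induction with
  | mem x hx =>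
    obtain ⟨j, rfl⟩ := hx
    rw [gammaHom_basis E hι, map_smulₛₗ, LinearMap.smul_apply, herm_basis_left,
      conj_gammaCoeff hc]
    induction E.mem_span y using Submodule.span_induction with
    | mem y hy =>
      obtain ⟨i, rfl⟩ := hy
      rw [omegaForm_basis]
      by_cases h : i = ι j
      · subst h
        rw [Omega_involution hι]
        simp
      · have h' : j ≠ ι i := fun e => h (by rw [e, hι i])
        simp [Omega, h, h']
    | zero => simp
    | add x y _ _ hx hy => simp [hx, hy, mul_add]
    | smul a x _ hx => simp [hx, mul_left_comm]
  | zero => simp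
  | add x y _ _ hx hy => simp [hx, hy]
  | smul a x _ hx => simp [hx]

/-- Each column of `Ω` has a single nonzero entry, equal to `±1`, so `γ` is antiunitary.
Consequently `γ` carries the reflection in `u` to the reflection in `γ u`. -/
theorem herm_gammaHom (E : Module.Basis ℕ+ ℂ V) {c : ℂ} (hc : c = 1 ∨ c = -1) {ι : ℕ+ → ℕ+}
    (hι : Function.Involutive ι) (x y : V) :
    herm E (gammaHom E c ι x) (gammaHom E c ι y) = conj (herm E x y) := by
  induction E.mem_span x using Submodule.span_induction with
  | mem x hx =>
    obtain ⟨j, rfl⟩ := hx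
    rw [gammaHom_basis E hι, map_smulₛₗ, LinearMap.smul_apply, herm_basis_left,
      herm_basis_left, gammaHom_repr E hι, smul_eq_mul, ← mul_assoc,
      conj_mul_self_gammaCoeff hc, one_mul]
  | zero => simp
  | add x y _ _ hx hy => simp [hx, hy]
  | smul a x _ hx => simp [hx]

theorem sgn_eq (N : Set ℕ+) (ℓ : ℕ+) : sgn N ℓ = 1 ∨ sgn N ℓ = -1 := by
  unfold sgn
  split_ifs <;> simp

theorem sgn_ne_zero (N : Set ℕ+) (ℓ : ℕ+) : sgn N ℓ ≠ 0 := by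
  rcases sgn_eq N ℓ with h | h <;> simp [h]

theorem conj_sgn (N : Set ℕ+) (ℓ : ℕ+) : conj (sgn N ℓ) = sgn N ℓ := by
  rcases sgn_eq N ℓ with h | h <;> simp [h]

@[simp]
theorem deltaMap_basis (E : Module.Basis ℕ+ ℂ V) (N : Set ℕ+) (ℓ : ℕ+) :
    deltaMap E N (E ℓ) = sgn N ℓ • E ℓ := by
  simp [deltaMap]

/-- `φ(x, y) = ⟨δ x, y⟩`. -/
theorem phiForm_eq_herm (E : Module.Basis ℕ+ ℂ V) (N : Set ℕ+) (x y : V) :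
    phiForm E N x y = herm E (deltaMap E N x) y := by
  induction E.mem_span x using Submodule.span_induction with
  | mem x hx =>
    obtain ⟨j, rfl⟩ := hx
    simp [phiForm, conj_sgn]
  | zero => simp [phiForm]
  | add x z _ _ hx hz =>
    rw [map_add, map_add, LinearMap.add_apply, ← hx, ← hz, phiForm, map_add,
      Finsupp.sum_add_index'] <;> simp [phiForm, add_mul]
  | smul a x _ hx =>
    rw [map_smul, map_smulₛₗ, LinearMap.smul_apply, ← hx, phiForm, map_smul,
      Finsupp.sum_smul_index' (by simp), phiForm, smul_eq_mul, Finsupp.mul_sum]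
    simp [mul_assoc]

end Structures

/-! ### Unitary reflections and their action on pairs of basis vectors. -/

section Reflections

variable {V : Type*} [AddCommGroup V] [Module ℂ V]

open ComplexConjugate

/-- The unitary reflection `x ↦ x - ⟨u, x⟩ u`, where `⟨u, u⟩ = 2`. -/
noncomputable def reflection (E : Module.Basis ℕ+ ℂ V) (u : V) (hu : herm E u u = 2) : V ≃ₗ[ℂ] V :=
  LinearEquiv.ofInvolutive (LinearMap.id - (herm E u).smulRight u) fun x => by
    simp [hu, mul_two]

theorem reflection_apply (E : Module.Basis ℕ+ ℂ V) {u : V} (hu : herm E u u = 2) (x : V) :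
    reflection E u hu x = x - herm E u x • u := rfl

theorem reflection_of_herm_eq_zero (E : Module.Basis ℕ+ ℂ V) {u : V} (hu : herm E u u = 2) {x : V}
    (h : herm E u x = 0) : reflection E u hu x = x := by
  simp [reflection_apply, h]

theorem reflection_mem_unitaryGroup (E : Module.Basis ℕ+ ℂ V) {u : V} (hu : herm E u u = 2) :
    reflection E u hu ∈ unitaryGroup E := by
  intro x y
  have h := conj_herm E u x
  simp only [reflection_apply, map_sub, LinearMap.sub_apply, map_smulₛₗ, LinearMap.smul_apply,
    smul_eq_mul, hu, RingHom.id_apply, h]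
  ring

theorem reflection_mem_GLinf (E : Module.Basis ℕ+ ℂ V) {u : V} (hu : herm E u u = 2) :
    reflection E u hu ∈ GLinf E := by
  obtain ⟨k, hk⟩ := (E.repr u).support.bddAbove
  refine Filter.eventually_atTop.2 ⟨k + 1, fun ℓ hℓ => reflection_of_herm_eq_zero E hu ?_⟩
  rw [herm_basis_right, map_eq_zero]
  by_contra h
  have h1 : ℓ ≤ k := hk (Finsupp.mem_support_iff.2 h)
  exact absurd (hℓ.trans h1) (PNat.lt_add_right k 1).not_ge

theorem herm_gammaHom_self (E : Module.Basis ℕ+ ℂ V) {c : ℂ} (hc : c = 1 ∨ c = -1) {ι : ℕ+ → ℕ+}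
    (hι : Function.Involutive ι) {u : V} (hu : herm E u u = 2) :
    herm E (gammaHom E c ι u) (gammaHom E c ι u) = 2 := by
  rw [herm_gammaHom E hc hι, hu, map_ofNat]

theorem gammaHom_reflection (E : Module.Basis ℕ+ ℂ V) {c : ℂ} (hc : c = 1 ∨ c = -1) {ι : ℕ+ → ℕ+}
    (hι : Function.Involutive ι) {u : V} (hu : herm E u u = 2) (x : V) :
    gammaHom E c ι (reflection E u hu x) =
      reflection E (gammaHom E c ι u) (herm_gammaHom_self E hc hι hu) (gammaHom E c ι x) := by
  rw [reflection_apply, reflection_apply, herm_gammaHom E hc hι, map_sub, map_smulₛₗ]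

/-- Because `ω` is obtained from `⟨ , ⟩` and `γ`, a unitary map commuting with `γ` preserves `ω`. -/
theorem mem_Ginf_of_commute (E : Module.Basis ℕ+ ℂ V) {c : ℂ} (hc : c = 1 ∨ c = -1) {ι : ℕ+ → ℕ+}
    (hι : Function.Involutive ι) {g : V ≃ₗ[ℂ] V} (h₁ : g ∈ GLinf E) (h₂ : g ∈ unitaryGroup E)
    (h₃ : ∀ x, gammaHom E c ι (g x) = g (gammaHom E c ι x)) : g ∈ Ginf E c ι := by
  refine ⟨h₁, fun x y => ?_⟩
  have h₂' : ∀ x y, herm E (g x) (g y) = herm E x y := h₂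
  change omegaForm E c ι (g x) (g y) = omegaForm E c ι x y
  rw [omegaForm_eq_herm E hc hι, omegaForm_eq_herm E hc hι, h₃, h₂']

theorem reflection_sub_basis (E : Module.Basis ℕ+ ℂ V) {i j : ℕ+} (hij : i ≠ j)
    (hu : herm E (E i - E j) (E i - E j) = 2) (ℓ : ℕ+) :
    reflection E _ hu (E ℓ) = E (Equiv.swap i j ℓ) := by
  rw [reflection_apply]
  by_cases h1 : ℓ = i
  · subst h1
    simp [hij]
  by_cases h2 : ℓ = j
  · subst h2
    simp [Ne.symm hij]
  rw [Equiv.swap_apply_of_ne_of_ne h1 h2]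
  simp [h1, h2]

theorem herm_sub_basis_self (E : Module.Basis ℕ+ ℂ V) {i j : ℕ+} (hij : i ≠ j) :
    herm E (E i - E j) (E i - E j) = 2 := by
  simp [hij, Ne.symm hij]
  norm_num

/-- On the plane of `e_i, e_k`, the reflection in `α a e_i - β b e_k` with `|a| = |b| = 1` has
diagonal entries `1 - α²` and `1 - β²`, and off-diagonal entries of modulus `αβ`. The three
equations make these `r`, `-r` and `r`; they force `r² = 1 - r²`, whence `r = √(1/2)`. -/
theorem exists_mixing_coeffs : ∃ α β r : ℝ, α * α = 1 - r ∧ β * β = 1 + r ∧ α * β = r := by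
  have h2 : √(1 / 2) * √(1 / 2) = (1 / 2 : ℝ) := Real.mul_self_sqrt (by norm_num)
  have h0 : 0 < √(1 / 2 : ℝ) := Real.sqrt_pos.2 (by norm_num)
  have h1 : √(1 / 2 : ℝ) ≤ 1 := by nlinarith
  refine ⟨√(1 - √(1 / 2)), √(1 + √(1 / 2)), √(1 / 2), Real.mul_self_sqrt (by linarith),
    Real.mul_self_sqrt (by linarith), ?_⟩
  rw [← Real.sqrt_mul (by linarith)]
  congr 1
  linarith

/-- The vector whose reflection maps `e_i` and `e_k` to multiples of `b⁻¹ e_i ± a⁻¹ e_k`. -/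
noncomputable def mixVector (E : Module.Basis ℕ+ ℂ V) (α β : ℝ) (i k : ℕ+) (a b : ℂ) : V :=
  ((α : ℂ) * a) • E i - ((β : ℂ) * b) • E k

section

variable {E : Module.Basis ℕ+ ℂ V} {α β r : ℝ} {i k : ℕ+} {a b : ℂ}

theorem herm_mixVector (y : V) : herm E (mixVector E α β i k a b) y =
    α * conj a * E.repr y i - β * conj b * E.repr y k := by
  simp [mixVector]

theorem herm_mixVector_self (hik : i ≠ k) (h1 : α * α = 1 - r) (h2 : β * β = 1 + r)
    (ha : conj a * a = 1) (hb : conj b * b = 1) :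
    herm E (mixVector E α β i k a b) (mixVector E α β i k a b) = 2 := by
  have h1' : (α : ℂ) * α = 1 - r := by exact_mod_cast h1
  have h2' : (β : ℂ) * β = 1 + r := by exact_mod_cast h2
  rw [herm_mixVector]
  simp only [mixVector, map_sub, map_smul, Module.Basis.repr_self, Finsupp.sub_apply,
    Finsupp.smul_apply, Finsupp.single_eq_same, Finsupp.single_eq_of_ne hik,
    Finsupp.single_eq_of_ne hik.symm, smul_eq_mul, mul_zero, mul_one, sub_zero, zero_sub]
  linear_combination (α * α : ℂ) * ha + (β * β : ℂ) * hb + h1' + h2'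

theorem reflection_mix_left (hik : i ≠ k) (h1 : α * α = 1 - r) (h3 : α * β = r)
    (ha : conj a * a = 1)
    (hu : herm E (mixVector E α β i k a b) (mixVector E α β i k a b) = 2) :
    reflection E _ hu (E i) = (r : ℂ) • E i + (r * (conj a * b)) • E k := by
  have h1' : (α : ℂ) * α = 1 - r := by exact_mod_cast h1
  have h3' : (α : ℂ) * β = r := by exact_mod_cast h3
  rw [reflection_apply, herm_mixVector, mixVector]
  simp only [Module.Basis.repr_self, Finsupp.single_eq_same, Finsupp.single_eq_of_ne hik.symm]
  match_scalars
  · linear_combination (-α * α : ℂ) * ha - h1'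
  · linear_combination (conj a * b) * h3'

theorem reflection_mix_right (hik : i ≠ k) (h2 : β * β = 1 + r) (h3 : α * β = r)
    (hb : conj b * b = 1)
    (hu : herm E (mixVector E α β i k a b) (mixVector E α β i k a b) = 2) :
    reflection E _ hu (E k) = (r * (a * conj b)) • E i - (r : ℂ) • E k := by
  have h2' : (β : ℂ) * β = 1 + r := by exact_mod_cast h2
  have h3' : (α : ℂ) * β = r := by exact_mod_cast h3
  rw [reflection_apply, herm_mixVector, mixVector]
  simp only [Module.Basis.repr_self, Finsupp.single_eq_same, Finsupp.single_eq_of_ne hik]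
  match_scalars
  · linear_combination (-β * β : ℂ) * hb - h2'
  · linear_combination (a * conj b) * h3'

theorem reflection_mix_of_ne {ℓ : ℕ+} (hi : ℓ ≠ i) (hk : ℓ ≠ k)
    (hu : herm E (mixVector E α β i k a b) (mixVector E α β i k a b) = 2) :
    reflection E _ hu (E ℓ) = E ℓ := by
  refine reflection_of_herm_eq_zero E hu ?_
  rw [herm_mixVector]
  simp [hi, hk]

/-- The images of `e_i` and `e_k` span the lines of `e_i + ā b e_k` and `e_i - ā b e_k`. As `i` and
`k` have opposite signs, `δ` flips the relative sign of the two coordinates and so exchanges these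
lines. -/
theorem deltaMap_reflection_mix_left (hik : i ≠ k) (h1 : α * α = 1 - r) (h2 : β * β = 1 + r)
    (h3 : α * β = r) (ha : conj a * a = 1) (hb : conj b * b = 1) {N : Set ℕ+}
    (hN : sgn N k = -sgn N i)
    (hu : herm E (mixVector E α β i k a b) (mixVector E α β i k a b) = 2) :
    deltaMap E N (reflection E _ hu (E i)) =
      (sgn N i * (conj a * b)) • reflection E _ hu (E k) := by
  rw [reflection_mix_left hik h1 h3 ha, reflection_mix_right hik h2 h3 hb]
  simp only [map_add, map_smul, deltaMap_basis, hN]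
  match_scalars
  · linear_combination (-sgn N i * r * conj b * b) * ha - (sgn N i * r) * hb
  · ring

theorem deltaMap_reflection_mix_right (hik : i ≠ k) (h1 : α * α = 1 - r) (h2 : β * β = 1 + r)
    (h3 : α * β = r) (ha : conj a * a = 1) (hb : conj b * b = 1) {N : Set ℕ+}
    (hN : sgn N k = -sgn N i)
    (hu : herm E (mixVector E α β i k a b) (mixVector E α β i k a b) = 2) :
    deltaMap E N (reflection E _ hu (E k)) =
      (sgn N i * (a * conj b)) • reflection E _ hu (E i) := by
  rw [reflection_mix_left hik h1 h3 ha, reflection_mix_right hik h2 h3 hb]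
  simp only [map_sub, map_smul, deltaMap_basis, hN]
  match_scalars
  · ring
  · linear_combination (-sgn N i * r * conj b * b) * ha - (sgn N i * r) * hb

theorem gammaHom_mixVector {c : ℂ} {ι : ℕ+ → ℕ+} (hι : Function.Involutive ι) :
    gammaHom E c ι (mixVector E α β i k a b) =
      mixVector E α β (ι i) (ι k) (conj a * gammaCoeff c ι i) (conj b * gammaCoeff c ι k) := by
  rw [mixVector, map_sub, map_smulₛₗ, map_smulₛₗ, gammaHom_basis E hι, gammaHom_basis E hι]
  simp [mixVector, smul_smul, mul_assoc]

end

theorem ne_zero_of_conj_mul {a b : ℂ} (ha : conj a * a = 1) (hb : conj b * b = 1) :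
    conj a * b ≠ 0 :=
  mul_ne_zero (left_ne_zero_of_mul_eq_one ha) (right_ne_zero_of_mul_eq_one hb)

end Reflections

/-! ### Infinite families of permutations. -/

section Families

open ComplexConjugate

theorem infinite_ne_ne (i j : ℕ+) : {n : ℕ+ | n ≠ i ∧ n ≠ j}.Infinite := by
  have h : {n : ℕ+ | n ≠ i ∧ n ≠ j} = ({i, j} : Set ℕ+)ᶜ := by
    ext n
    simp
  rw [h]
  exact (Set.toFinite _).infinite_compl

/-- The conjugated permutation sends `i` to `n`, so `n` can be read off from it. -/
theorem infinite_image_conj_swap (τ : Equiv.Perm ℕ+) {i : ℕ+} (hi : τ i ≠ i) :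
    ((fun n => Equiv.swap (τ i) n * τ * Equiv.swap (τ i) n) '' {n | n ≠ i ∧ n ≠ τ i}).Infinite := by
  refine (infinite_ne_ne i (τ i)).image fun m hm n hn h => ?_
  have key : ∀ n, n ≠ i → (Equiv.swap (τ i) n * τ * Equiv.swap (τ i) n) i = n := by
    intro n hn
    simp [Equiv.swap_apply_of_ne_of_ne hi.symm hn.symm]
  rw [← key m hm.1, ← key n hn.1]
  exact DFunLike.congr_fun h i

theorem infinite_image_swap (i : ℕ+) {S : Set ℕ+} (hS : S.Infinite) :
    ((fun n => Equiv.swap i n) '' S).Infinite := by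
  refine hS.image fun m _ n _ h => ?_
  have := DFunLike.congr_fun h i
  simpa using this

/-- The transposition does not distinguish `k` from `ι k`, so the map is not injective in general;
its fibres have at most two elements. -/
theorem infinite_image_swap_involution {ι : ℕ+ → ℕ+} {S : Set ℕ+} (hS : S.Infinite)
    (hfix : ∀ k ∈ S, ι k ≠ k) : ((fun k => Equiv.swap k (ι k)) '' S).Infinite := by
  intro hfin
  refine hS (Set.Finite.of_finite_fibers (fun k => Equiv.swap k (ι k)) hfin ?_)
  rintro _ ⟨k₀, -, rfl⟩
  refine (Set.toFinite ({k₀, ι k₀} : Set ℕ+)).subset fun k hk => ?_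
  by_contra hne
  simp only [Set.mem_insert_iff, Set.mem_singleton_iff, not_or] at hne
  have h := DFunLike.congr_fun hk.2 k
  rw [Equiv.swap_apply_left, Equiv.swap_apply_of_ne_of_ne hne.1 hne.2] at h
  exact hfix k hk.1 h

theorem infinite_image_double_swap {ι : ℕ+ → ℕ+} (hι : Function.Involutive ι) (k : ℕ+) {S : Set ℕ+}
    (hS : S.Infinite) (h : ∀ i ∈ S, i ≠ ι k) (hk : ι k ≠ k) :
    ((fun i => Equiv.swap i k * Equiv.swap (ι i) (ι k)) '' S).Infinite := by
  refine hS.image fun m hm n hn hmn => ?_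
  have key : ∀ i ∈ S, (Equiv.swap i k * Equiv.swap (ι i) (ι k)) k = i := by
    intro i hi
    have h1 : k ≠ ι i := fun e => h i hi (by rw [e, hι i])
    simp [Equiv.swap_apply_of_ne_of_ne h1 hk.symm]
  rw [← key m hm, ← key n hn]
  exact DFunLike.congr_fun hmn k

end Families

/-! ### Elements of the group realizing the permutations. -/

section Cases

variable {V : Type*} [AddCommGroup V] [Module ℂ V] (E : Module.Basis ℕ+ ℂ V)

open ComplexConjugate

/-- Transpositions realize the conjugates of the involution of `Ω`. -/
theorem exists_monomial_conj_swap {c : ℂ} (hc : c = 1 ∨ c = -1) {ι : ℕ+ → ℕ+}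
    (hι : Function.Involutive ι) {i j : ℕ+} (hij : i ≠ j) :
    ∃ g ∈ GLinf E, g ∈ unitaryGroup E ∧ IsMonomialAt E (gammaHom E c ι) g
      (Equiv.swap i j * hι.toPerm * Equiv.swap i j) := by
  have hu := herm_sub_basis_self E hij
  refine ⟨_, reflection_mem_GLinf E hu, reflection_mem_unitaryGroup E hu, fun ℓ => ?_⟩
  refine ⟨gammaCoeff c ι (Equiv.swap i j ℓ), gammaCoeff_ne_zero hc _ _, ?_⟩
  rw [reflection_sub_basis E hij, reflection_sub_basis E hij, gammaHom_basis E hι]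
  simp

/-- The case of the identity matrix `Ω`. -/
theorem exists_monomial_swap_of_id {i k : ℕ+} (hik : i ≠ k) :
    ∃ g ∈ GLinf E, g ∈ unitaryGroup E ∧ IsMonomialAt E (gammaHom E 1 id) g (Equiv.swap i k) := by
  obtain ⟨α, β, r, h1, h2, h3⟩ := exists_mixing_coeffs
  have hI : conj Complex.I * Complex.I = 1 := by simp
  have hone : conj (1 : ℂ) * 1 = 1 := by simp
  have hid : Function.Involutive (id : ℕ+ → ℕ+) := fun _ => rfl
  have hγ : ∀ ℓ, gammaHom E 1 id (E ℓ) = E ℓ := fun ℓ => by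
    rw [gammaHom_basis E hid]
    simp [gammaCoeff]
  -- With `a = 1` and `b = i` (imaginary unit) the two image lines are the isotropic lines of the
  -- plane, which complex conjugation exchanges.
  have hu := herm_mixVector_self (E := E) hik h1 h2 hone hI
  refine ⟨_, reflection_mem_GLinf E hu, reflection_mem_unitaryGroup E hu, fun ℓ => ?_⟩
  by_cases hi : ℓ = i
  · subst hi
    refine ⟨Complex.I, Complex.I_ne_zero, ?_⟩
    rw [Equiv.swap_apply_left, reflection_mix_left hik h1 h3 hone,
      reflection_mix_right hik h2 h3 hI, map_add, map_smulₛₗ, map_smulₛₗ, hγ, hγ]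
    simp only [map_mul, map_one, one_mul, Complex.conj_ofReal, Complex.conj_I]
    match_scalars
    · linear_combination (r : ℂ) * Complex.I_mul_I
    · ring
  by_cases hk : ℓ = k
  · subst hk
    refine ⟨Complex.I, Complex.I_ne_zero, ?_⟩
    rw [Equiv.swap_apply_right, reflection_mix_left hik h1 h3 hone,
      reflection_mix_right hik h2 h3 hI, map_sub, map_smulₛₗ, map_smulₛₗ, hγ, hγ]
    simp only [map_mul, map_one, one_mul, Complex.conj_ofReal, Complex.conj_I, map_neg, neg_neg]
    match_scalars
    · ring
    · linear_combination (-r : ℂ) * Complex.I_mul_I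
  refine ⟨1, one_ne_zero, ?_⟩
  rw [Equiv.swap_apply_of_ne_of_ne hi hk, reflection_mix_of_ne hi hk, hγ, one_smul]

theorem exists_monomial_swap {N : Set ℕ+} {i k : ℕ+} (hN : sgn N k = -sgn N i) :
    ∃ g ∈ GLinf E, g ∈ unitaryGroup E ∧ IsMonomialAt E (deltaMap E N) g (Equiv.swap i k) := by
  obtain ⟨α, β, r, h1, h2, h3⟩ := exists_mixing_coeffs
  have hik : i ≠ k := by
    rintro rfl
    exact sgn_ne_zero N i (self_eq_neg.1 hN)
  have hone : conj (1 : ℂ) * 1 = 1 := by simp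
  have hu := herm_mixVector_self (E := E) hik h1 h2 hone hone
  refine ⟨_, reflection_mem_GLinf E hu, reflection_mem_unitaryGroup E hu, fun ℓ => ?_⟩
  by_cases hi : ℓ = i
  · subst hi
    rw [Equiv.swap_apply_left]
    exact ⟨_, by simp [sgn_ne_zero], deltaMap_reflection_mix_left hik h1 h2 h3 hone hone hN hu⟩
  by_cases hk : ℓ = k
  · subst hk
    rw [Equiv.swap_apply_right]
    exact ⟨_, by simp [sgn_ne_zero], deltaMap_reflection_mix_right hik h1 h2 h3 hone hone hN hu⟩
  refine ⟨sgn N ℓ, sgn_ne_zero N ℓ, ?_⟩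
  rw [Equiv.swap_apply_of_ne_of_ne hi hk, reflection_mix_of_ne hi hk, deltaMap_basis]

/-- Needed because `γ` returns to `u` only up to the sign `c`. -/
theorem reflection_congr {u v : V} (hu : herm E u u = 2) (hv : herm E v v = 2) {a : ℂ}
    (ha : conj a * a = 1) (h : v = a • u) (x : V) : reflection E v hv x = reflection E u hu x := by
  subst h
  rw [reflection_apply, reflection_apply, map_smulₛₗ, LinearMap.smul_apply, smul_smul, smul_eq_mul]
  congr 2
  linear_combination (herm E u x) * ha

theorem reflection_comm {u v : V} (hu : herm E u u = 2) (hv : herm E v v = 2)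
    (h : herm E u v = 0) (x : V) :
    reflection E u hu (reflection E v hv x) = reflection E v hv (reflection E u hu x) := by
  have h' : herm E v u = 0 := by rw [← conj_herm, h, map_zero]
  simp only [reflection_apply, map_sub, map_smul, h, h', zero_smul, sub_zero]
  abel

/-- The mixing reflection in `u`, on the pair `i, k`, is completed by the one in `v = γ u`, on the
pair `ι i, ι k`. The pairs are disjoint, so the reflections commute; `γ` exchanges them, so their
product commutes with `γ` and preserves `ω`. Then `δ` exchanges the image lines within each pair. -/
theorem exists_monomial_double_swap {c : ℂ} (hc : c = 1 ∨ c = -1) {ι : ℕ+ → ℕ+}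
    (hι : Function.Involutive ι) {N : Set ℕ+} {i k : ℕ+} (hi : ι i ≠ i) (hk : ι k ≠ k)
    (hki : i ≠ ι k) (hN : sgn N k = -sgn N i) (hN' : sgn N (ι k) = -sgn N (ι i)) :
    ∃ g ∈ Ginf E c ι, g ∈ unitaryGroup E ∧ IsMonomialAt E (deltaMap E N) g
      (Equiv.swap i k * Equiv.swap (ι i) (ι k)) := by
  obtain ⟨α, β, r, h1, h2, h3⟩ := exists_mixing_coeffs
  have hik : i ≠ k := by
    rintro rfl
    exact sgn_ne_zero N i (self_eq_neg.1 hN)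
  have hik' : ι i ≠ ι k := hι.injective.ne hik
  have hki' : k ≠ ι i := fun e => hki (by rw [e, hι i])
  have hone : conj (1 : ℂ) * 1 = 1 := by simp
  have hcc : conj c * c = 1 := by rcases hc with rfl | rfl <;> simp
  set s := gammaCoeff c ι i with hs
  set t := gammaCoeff c ι k with ht
  have hss : conj s * s = 1 := conj_mul_self_gammaCoeff hc ι i
  have htt : conj t * t = 1 := conj_mul_self_gammaCoeff hc ι k
  set u := mixVector E α β i k 1 1 with hudef
  set v := mixVector E α β (ι i) (ι k) s t with hvdef
  have hu : herm E u u = 2 := herm_mixVector_self hik h1 h2 hone hone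
  have hv : herm E v v = 2 := herm_mixVector_self hik' h1 h2 hss htt
  have huv : gammaHom E c ι u = v := by
    rw [hudef, gammaHom_mixVector hι]
    simp [hvdef, hs, ht]
  have hvu : gammaHom E c ι v = c • u := by
    rw [hvdef, gammaHom_mixVector hι, hι i, hι k, hs, ht, conj_gammaCoeff hc, conj_gammaCoeff hc,
      gammaCoeff_mul hι hi, gammaCoeff_mul hι hk, hudef, mixVector, mixVector]
    match_scalars <;> ring
  have horth : herm E u v = 0 := by
    rw [hudef, herm_mixVector, hvdef, mixVector]
    simp [hi.symm, hk.symm, hki, hki']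
  have hgu : ∀ x, gammaHom E c ι (reflection E u hu x) = reflection E v hv (gammaHom E c ι x) := by
    intro x
    rw [gammaHom_reflection E hc hι]
    exact reflection_congr E hv _ (a := 1) hone (by rw [huv, one_smul]) _
  have hgv : ∀ x, gammaHom E c ι (reflection E v hv x) = reflection E u hu (gammaHom E c ι x) := by
    intro x
    rw [gammaHom_reflection E hc hι]
    exact reflection_congr E hu _ hcc hvu _
  have hunit := (unitaryGroup E).mul_mem (reflection_mem_unitaryGroup E hu)
    (reflection_mem_unitaryGroup E hv)
  refine ⟨reflection E u hu * reflection E v hv, ?_, hunit, fun ℓ => ?_⟩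
  · refine mem_Ginf_of_commute E hc hι ((GLinf E).mul_mem (reflection_mem_GLinf E hu)
      (reflection_mem_GLinf E hv)) hunit fun x => ?_
    rw [LinearEquiv.mul_apply, LinearEquiv.mul_apply, hgu, hgv, reflection_comm E hu hv horth]
  · simp only [LinearEquiv.mul_apply, Equiv.Perm.mul_apply]
    have hfixu : ∀ {ℓ}, ℓ ≠ i → ℓ ≠ k → reflection E u hu (E ℓ) = E ℓ :=
      fun h h' => reflection_mix_of_ne h h' hu
    have hfixv : ∀ {ℓ}, ℓ ≠ ι i → ℓ ≠ ι k → reflection E v hv (E ℓ) = E ℓ :=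
      fun h h' => reflection_mix_of_ne h h' hv
    have hi1 : reflection E u hu (reflection E v hv (E (ι i))) = reflection E v hv (E (ι i)) := by
      rw [reflection_comm E hu hv horth, hfixu hi hki'.symm]
    have hk1 : reflection E u hu (reflection E v hv (E (ι k))) = reflection E v hv (E (ι k)) := by
      rw [reflection_comm E hu hv horth, hfixu hki.symm hk]
    by_cases e1 : ℓ = i
    · subst e1
      rw [Equiv.swap_apply_of_ne_of_ne hi.symm hki, Equiv.swap_apply_left, hfixv hi.symm hki,
        hfixv hki' hk.symm]
      exact ⟨_, by simp [sgn_ne_zero], deltaMap_reflection_mix_left hik h1 h2 h3 hone hone hN hu⟩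
    by_cases e2 : ℓ = k
    · subst e2
      rw [Equiv.swap_apply_of_ne_of_ne hki' hk.symm, Equiv.swap_apply_right, hfixv hi.symm hki,
        hfixv hki' hk.symm]
      exact ⟨_, by simp [sgn_ne_zero], deltaMap_reflection_mix_right hik h1 h2 h3 hone hone hN hu⟩
    by_cases e3 : ℓ = ι i
    · subst e3
      rw [Equiv.swap_apply_left, Equiv.swap_apply_of_ne_of_ne hki.symm hk, hi1, hk1]
      exact ⟨_, mul_ne_zero (sgn_ne_zero N _) (ne_zero_of_conj_mul hss htt),
        deltaMap_reflection_mix_left hik' h1 h2 h3 hss htt hN' hv⟩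
    by_cases e4 : ℓ = ι k
    · subst e4
      rw [Equiv.swap_apply_right, Equiv.swap_apply_of_ne_of_ne hi hki'.symm, hi1, hk1]
      refine ⟨_, mul_ne_zero (sgn_ne_zero N _) ?_,
        deltaMap_reflection_mix_right hik' h1 h2 h3 hss htt hN' hv⟩
      rw [mul_comm]
      exact ne_zero_of_conj_mul htt hss
    refine ⟨sgn N ℓ, sgn_ne_zero N ℓ, ?_⟩
    rw [Equiv.swap_apply_of_ne_of_ne e3 e4, Equiv.swap_apply_of_ne_of_ne e1 e2, hfixv e3 e4,
      hfixu e1 e2, deltaMap_basis]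

/-- The vector `u = r e_k - e_i + r e_{ι k}` is fixed by `γ`, so a single reflection preserves `ω`.
It fixes `e_k - e_{ι k}` and exchanges `e_i` with `r (e_k + e_{ι k})`. Thus `e_k` and `e_{ι k}` go
to `r e_i ± (e_k - e_{ι k}) / 2`, which `δ` exchanges up to sign because it acts on the two terms
with opposite signs. -/
theorem exists_monomial_swap_of_fixed {ι : ℕ+ → ℕ+} (hι : Function.Involutive ι) {N : Set ℕ+}
    {i k : ℕ+} (hi : ι i = i) (hk : ι k ≠ k) (hN : sgn N i = -sgn N k)
    (hN' : sgn N (ι k) = sgn N k) :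
    ∃ g ∈ Ginf E 1 ι, g ∈ unitaryGroup E ∧ IsMonomialAt E (deltaMap E N) g
      (Equiv.swap k (ι k)) := by
  obtain ⟨r, hr, hr'⟩ : ∃ r : ℂ, conj r = r ∧ r * r = 1 / 2 := by
    refine ⟨(√(1 / 2) : ℝ), Complex.conj_ofReal _, ?_⟩
    rw [← Complex.ofReal_mul, Real.mul_self_sqrt (by norm_num)]
    norm_num
  have hik : k ≠ i := by
    rintro rfl
    exact hk hi
  have hik' : ι k ≠ i := fun e => hik (by rw [← hι k, e, hi])
  have hγ : ∀ ℓ, gammaHom E 1 ι (E ℓ) = E (ι ℓ) := fun ℓ => by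
    rw [gammaHom_basis E hι]
    simp [gammaCoeff]
  set u := r • E k - E i + r • E (ι k) with hudef
  have hherm : ∀ y, herm E u y = r * E.repr y k - E.repr y i + r * E.repr y (ι k) := by
    intro y
    simp [hudef, hr]
  have hu : herm E u u = 2 := by
    rw [hherm, hudef]
    simp [hik, hik.symm, hik', hik'.symm, hk, hk.symm]
    linear_combination 2 * hr'
  have hγu : gammaHom E 1 ι u = u := by
    simp only [hudef, map_add, map_sub, map_smulₛₗ, hγ, hi, hι k, hr]
    abel
  have e1 : reflection E u hu (E k) =
      (1 / 2 : ℂ) • E k + r • E i - (1 / 2 : ℂ) • E (ι k) := by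
    rw [reflection_apply, hherm, hudef]
    simp only [Module.Basis.repr_self, Finsupp.single_eq_same, Finsupp.single_eq_of_ne hik.symm,
      Finsupp.single_eq_of_ne hk]
    match_scalars
    · linear_combination -hr'
    · ring
    · linear_combination -hr'
  have e2 : reflection E u hu (E (ι k)) =
      -(1 / 2 : ℂ) • E k + r • E i + (1 / 2 : ℂ) • E (ι k) := by
    rw [reflection_apply, hherm, hudef]
    simp only [Module.Basis.repr_self, Finsupp.single_eq_same, Finsupp.single_eq_of_ne hik'.symm,
      Finsupp.single_eq_of_ne hk.symm]
    match_scalars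
    · linear_combination -hr'
    · linear_combination -hr'
    · ring
  have e3 : reflection E u hu (E i) = r • E k + r • E (ι k) := by
    rw [reflection_apply, hherm, hudef]
    simp only [Module.Basis.repr_self, Finsupp.single_eq_same, Finsupp.single_eq_of_ne hik,
      Finsupp.single_eq_of_ne hik']
    match_scalars <;> ring
  refine ⟨reflection E u hu, ?_, reflection_mem_unitaryGroup E hu, fun ℓ => ?_⟩
  · refine mem_Ginf_of_commute E (Or.inl rfl) hι (reflection_mem_GLinf E hu)
      (reflection_mem_unitaryGroup E hu) fun x => ?_
    rw [gammaHom_reflection E (Or.inl rfl) hι]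
    exact reflection_congr E hu _ (a := 1) (by simp) (by rw [hγu, one_smul]) _
  · by_cases h1 : ℓ = k
    · subst h1
      refine ⟨-sgn N ℓ, neg_ne_zero.2 (sgn_ne_zero N ℓ), ?_⟩
      rw [Equiv.swap_apply_left, e1, e2]
      simp only [map_add, map_sub, map_smul, deltaMap_basis, hN, hN']
      match_scalars <;> ring
    by_cases h2 : ℓ = ι k
    · subst h2
      refine ⟨-sgn N k, neg_ne_zero.2 (sgn_ne_zero N k), ?_⟩
      rw [Equiv.swap_apply_right, e1, e2]
      simp only [map_add, map_smul, deltaMap_basis, hN, hN']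
      match_scalars <;> ring
    rw [Equiv.swap_apply_of_ne_of_ne h1 h2]
    by_cases h3 : ℓ = i
    · subst h3
      refine ⟨sgn N k, sgn_ne_zero N k, ?_⟩
      rw [e3]
      simp only [map_add, map_smul, deltaMap_basis, hN']
      match_scalars <;> ring
    refine ⟨sgn N ℓ, sgn_ne_zero N ℓ, ?_⟩
    have : reflection E u hu (E ℓ) = E ℓ := by
      refine reflection_of_herm_eq_zero E hu ?_
      rw [hherm]
      simp [h1, h2, h3]
    rw [this, deltaMap_basis]

end Cases

/-! ### The infinite families of orbits in each type. -/

section Theorems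

variable {V : Type*} [AddCommGroup V] [Module ℂ V] {E : Module.Basis ℕ+ ℂ V}
  {A : Type} [LinearOrder A] {σ : ℕ+ → A}

theorem Ginf_le_GLinf {c : ℂ} {ι : ℕ+ → ℕ+} : Ginf E c ι ≤ GLinf E := inf_le_left

theorem preserving_phiForm_le (N : Set ℕ+) :
    preserving (phiForm E N) ≤ preserving fun x y => herm E (deltaMap E N x) y := by
  intro g hg x y
  change herm E (deltaMap E N (g x)) (g y) = herm E (deltaMap E N x) y
  rw [← phiForm_eq_herm, ← phiForm_eq_herm]
  exact hg x y

theorem Ginf_le_preserving {c : ℂ} (hc : c = 1 ∨ c = -1) {ι : ℕ+ → ℕ+}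
    (hι : Function.Involutive ι) :
    Ginf E c ι ≤ preserving fun x y => herm E (gammaHom E c ι x) y := by
  intro g hg x y
  change herm E (gammaHom E c ι (g x)) (g y) = herm E (gammaHom E c ι x) y
  rw [← omegaForm_eq_herm E hc hι, ← omegaForm_eq_herm E hc hι]
  exact hg.2 y x

/-- Types A1 and A2. -/
theorem infinite_orbitSets_gamma (hσ : Function.Injective σ)
    (hch : IsChain (· ≤ ·) (flagOf σ E)) {c : ℂ} {ι : ℕ+ → ℕ+} (hι : Function.Involutive ι)
    (hc : c = 1 ∨ c = -1 ∧ ∀ ℓ, ι ℓ ≠ ℓ) :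
    Infinite (OrbitSet (GLinf E) (Ginf E c ι) (flagOf σ E)) ∧
      Infinite (OrbitSet (GLinf E) (GLinf E ⊓ commuting (gammaMap E c ι)) (flagOf σ E)) := by
  have hc' : c = 1 ∨ c = -1 := hc.imp_right And.left
  have hle : GLinf E ⊓ commuting (gammaMap E c ι) ≤ commuting (gammaHom E c ι) := inf_le_right
  by_cases hfix : ∃ i, ι i ≠ i
  · obtain ⟨i, hi⟩ := hfix
    -- Here `𝐊` preserves the form and `𝐆⁰` commutes with `γ`, the reverse of the types defined by
    -- `δ`; hence the final symmetry.
    refine (infinite_orbitSets hσ hch (gammaHom E c ι) le_rfl hle (Ginf_le_preserving hc' hι)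
      (infinite_image_conj_swap hι.toPerm hi) ?_).symm
    rintro _ ⟨n, hn, rfl⟩
    exact exists_monomial_conj_swap E hc' hι hn.2.symm
  -- For `ι = id` conjugates of the involution are all trivial, so transpositions coming from pairs
  -- of isotropic lines are used instead.
  · push Not at hfix
    obtain rfl : ι = id := funext hfix
    obtain rfl : c = 1 := hc.resolve_right fun h => h.2 1 rfl
    refine (infinite_orbitSets hσ hch (gammaHom E 1 id) le_rfl hle (Ginf_le_preserving hc' hι)
      (infinite_image_swap 1 (infinite_ne_ne 1 1)) ?_).symm
    rintro _ ⟨n, hn, rfl⟩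
    exact exists_monomial_swap_of_id E hn.1.symm

theorem sgn_of_mem {N : Set ℕ+} {ℓ : ℕ+} (h : ℓ ∈ N) : sgn N ℓ = 1 := if_pos h

theorem sgn_of_not_mem {N : Set ℕ+} {ℓ : ℕ+} (h : ℓ ∉ N) : sgn N ℓ = -1 := if_neg h

/-- Type A3. -/
theorem infinite_orbitSets_delta (hσ : Function.Injective σ)
    (hch : IsChain (· ≤ ·) (flagOf σ E)) {N : Set ℕ+} (pos : N.Nonempty) (neg : Nᶜ.Nonempty) :
    Infinite (OrbitSet (GLinf E) (GLinf E ⊓ commuting (deltaMap E N)) (flagOf σ E)) ∧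
      Infinite (OrbitSet (GLinf E) (GLinf E ⊓ preserving (phiForm E N)) (flagOf σ E)) := by
  obtain ⟨i, S, hS, hN⟩ : ∃ (i : ℕ+) (S : Set ℕ+), S.Infinite ∧ ∀ k ∈ S, sgn N k = -sgn N i := by
    obtain ⟨i, hi⟩ := pos
    obtain ⟨k, hk⟩ := neg
    -- One of the two sides is infinite and supplies `S`; the fixed index is taken on the other.
    by_cases hfin : N.Finite
    · exact ⟨i, Nᶜ, hfin.infinite_compl, fun k hk => by rw [sgn_of_mem hi, sgn_of_not_mem hk]⟩
    · exact ⟨k, N, hfin, fun i hi => by rw [sgn_of_mem hi, sgn_of_not_mem hk, neg_neg]⟩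
  refine infinite_orbitSets hσ hch (deltaMap E N) le_rfl inf_le_right
    (inf_le_right.trans (preserving_phiForm_le N)) (infinite_image_swap i hS) ?_
  rintro _ ⟨k, hk, rfl⟩
  exact exists_monomial_swap E (hN k hk)

/-- Types BD1, C1, C2 and D3, when both `N₊` and `N₋` meet a block of size two. -/
theorem infinite_orbitSets_omega_delta (hσ : Function.Injective σ)
    (hch : IsChain (· ≤ ·) (flagOf σ E)) {c : ℂ} (hc : c = 1 ∨ c = -1) {ι : ℕ+ → ℕ+}
    (hι : Function.Involutive ι) {N S : Set ℕ+} {k : ℕ+} (hk : ι k ≠ k) (hS : S.Infinite)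
    (hSι : ∀ i ∈ S, ι i ≠ i) (hN : ∀ i ∈ S, sgn N k = -sgn N i)
    (hN' : ∀ i ∈ S, sgn N (ι k) = -sgn N (ι i)) :
    Infinite (OrbitSet (Ginf E c ι) (Ginf E c ι ⊓ commuting (deltaMap E N)) (flagOf σ E)) ∧
      Infinite (OrbitSet (Ginf E c ι) (Ginf E c ι ⊓ preserving (phiForm E N)) (flagOf σ E)) := by
  -- The index `ι k` is removed from `S` so that the pairs `i, k` and `ι i, ι k` stay disjoint.
  refine infinite_orbitSets hσ hch (deltaMap E N) Ginf_le_GLinf inf_le_right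
    (inf_le_right.trans (preserving_phiForm_le N))
    (infinite_image_double_swap hι k (hS.sdiff (Set.finite_singleton (ι k)))
      (fun i hi => hi.2) hk) ?_
  rintro _ ⟨i, ⟨hi, hik⟩, rfl⟩
  exact exists_monomial_double_swap E hc hι (hSι i hi) hk hik (hN i hi) (hN' i hi)

/-- Type BD1, when one of `N₊` and `N₋` is reduced to a block of size one. -/
theorem infinite_orbitSets_omega_delta_of_fixed (hσ : Function.Injective σ)
    (hch : IsChain (· ≤ ·) (flagOf σ E)) {ι : ℕ+ → ℕ+} (hι : Function.Involutive ι)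
    {N S : Set ℕ+} {i : ℕ+} (hi : ι i = i) (hS : S.Infinite) (hSι : ∀ k ∈ S, ι k ≠ k)
    (hN : ∀ k ∈ S, sgn N i = -sgn N k) (hN' : ∀ k ∈ S, sgn N (ι k) = sgn N k) :
    Infinite (OrbitSet (Ginf E 1 ι) (Ginf E 1 ι ⊓ commuting (deltaMap E N)) (flagOf σ E)) ∧
      Infinite (OrbitSet (Ginf E 1 ι) (Ginf E 1 ι ⊓ preserving (phiForm E N)) (flagOf σ E)) := by
  refine infinite_orbitSets hσ hch (deltaMap E N) Ginf_le_GLinf inf_le_right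
    (inf_le_right.trans (preserving_phiForm_le N)) (infinite_image_swap_involution hS hSι) ?_
  rintro _ ⟨k, hk, rfl⟩
  exact exists_monomial_swap_of_fixed E hι hi (hSι k hk) (hN k hk) (hN' k hk)

theorem exists_infinite_side (N : Set ℕ+) : ∃ T : Set ℕ+, T.Infinite ∧ (T = N ∨ T = Nᶜ) := by
  by_cases h : N.Finite
  · exact ⟨Nᶜ, h.infinite_compl, Or.inr rfl⟩
  · exact ⟨N, h, Or.inl rfl⟩

theorem sgn_eq_of_side {N T : Set ℕ+} (hT : T = N ∨ T = Nᶜ) {a b : ℕ+} (h : a ∈ T ↔ b ∈ T) :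
    sgn N a = sgn N b := by
  have h' : a ∈ N ↔ b ∈ N := by
    rcases hT with rfl | rfl
    · exact h
    · exact not_iff_not.1 h
  by_cases ha : a ∈ N
  · rw [sgn_of_mem ha, sgn_of_mem (h'.1 ha)]
  · rw [sgn_of_not_mem ha, sgn_of_not_mem fun hb => ha (h'.2 hb)]

theorem sgn_neg_of_side {N T : Set ℕ+} (hT : T = N ∨ T = Nᶜ) {a b : ℕ+} (ha : a ∈ T)
    (hb : b ∉ T) : sgn N b = -sgn N a := by
  rcases hT with rfl | rfl
  · rw [sgn_of_mem ha, sgn_of_not_mem hb]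
  · rw [sgn_of_not_mem ha, sgn_of_mem (not_not.1 hb), neg_neg]

/-- Types BD1 and C2. -/
theorem infinite_orbitSets_of_stable (hσ : Function.Injective σ)
    (hch : IsChain (· ≤ ·) (flagOf σ E)) {c : ℂ} {ι : ℕ+ → ℕ+} (hι : Function.Involutive ι)
    (hc : c = 1 ∨ c = -1 ∧ ∀ ℓ, ι ℓ ≠ ℓ) (hfix : ∀ p q, ι p = p → ι q = q → p = q)
    {N : Set ℕ+} (pos : N.Nonempty) (neg : Nᶜ.Nonempty) (stable : ∀ ℓ, ℓ ∈ N ↔ ι ℓ ∈ N) :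
    Infinite (OrbitSet (Ginf E c ι) (Ginf E c ι ⊓ commuting (deltaMap E N)) (flagOf σ E)) ∧
      Infinite (OrbitSet (Ginf E c ι) (Ginf E c ι ⊓ preserving (phiForm E N)) (flagOf σ E)) := by
  obtain ⟨T, hTinf, hT⟩ := exists_infinite_side N
  have hTι : ∀ ℓ, sgn N (ι ℓ) = sgn N ℓ := fun ℓ => sgn_eq_of_side (Or.inl rfl) (stable ℓ).symm
  have hne : Tᶜ.Nonempty := by
    rcases hT with rfl | rfl
    · exact neg
    · rwa [compl_compl]
  -- In type BD1 this is where isotropy of the flag matters: with at most one block of size one, the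
  -- infinite side still contains infinitely many indices from blocks of size two.
  have hfin : {ℓ | ι ℓ = ℓ}.Finite := Set.Subsingleton.finite fun p hp q hq => hfix p q hp hq
  have hS : (T \ {ℓ | ι ℓ = ℓ}).Infinite := hTinf.sdiff hfin
  by_cases hk : ∃ k ∉ T, ι k ≠ k
  · obtain ⟨k, hkT, hk⟩ := hk
    refine infinite_orbitSets_omega_delta hσ hch (hc.imp_right And.left) hι hk hS
      (fun i hi => hi.2) (fun i hi => sgn_neg_of_side hT hi.1 hkT) fun i hi => ?_
    rw [hTι, hTι]
    exact sgn_neg_of_side hT hi.1 hkT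
  -- The other side now consists of fixed points of `ι`, so no double swap is available; a fixed
  -- point also excludes the symplectic case.
  · push Not at hk
    obtain ⟨i, hi⟩ := hne
    obtain rfl : c = 1 := hc.resolve_right fun h => h.2 i (hk i hi)
    exact infinite_orbitSets_omega_delta_of_fixed hσ hch hι (hk i hi) hS (fun k hk => hk.2)
      (fun k hk => sgn_neg_of_side hT hk.1 hi) fun k _ => hTι k

/-- Types C1 and D3. -/
theorem infinite_orbitSets_of_swap (hσ : Function.Injective σ)
    (hch : IsChain (· ≤ ·) (flagOf σ E)) {c : ℂ} (hc : c = 1 ∨ c = -1) {ι : ℕ+ → ℕ+}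
    (hι : Function.Involutive ι) {N : Set ℕ+} (swap : ∀ ℓ, ℓ ∈ N ↔ ι ℓ ∈ Nᶜ) :
    Infinite (OrbitSet (Ginf E c ι) (Ginf E c ι ⊓ commuting (deltaMap E N)) (flagOf σ E)) ∧
      Infinite (OrbitSet (Ginf E c ι) (Ginf E c ι ⊓ preserving (phiForm E N)) (flagOf σ E)) := by
  obtain ⟨T, hTinf, hT⟩ := exists_infinite_side N
  have hnofix : ∀ ℓ, ι ℓ ≠ ℓ := by
    intro ℓ h
    have := swap ℓ
    rw [h] at this
    exact iff_not_self this
  have hTι : ∀ ℓ, sgn N (ι ℓ) = -sgn N ℓ := by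
    intro ℓ
    by_cases h : ℓ ∈ N
    · exact sgn_neg_of_side (Or.inl rfl) h ((swap ℓ).1 h)
    · rw [sgn_neg_of_side (Or.inl rfl) (not_not.1 fun h' => h ((swap ℓ).2 h')) h, neg_neg]
  -- Since `ι` exchanges the two sides, `ι j` serves as the fixed index opposite to `T`.
  obtain ⟨j, hj⟩ := hTinf.nonempty
  have hkT : ι j ∉ T := fun h =>
    sgn_ne_zero N j (self_eq_neg.1 ((sgn_eq_of_side hT (iff_of_true hj h)).trans (hTι j)))
  refine infinite_orbitSets_omega_delta hσ hch hc hι (hnofix (ι j)) hTinf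
    (fun i _ => hnofix i) (fun i hi => sgn_neg_of_side hT hi hkT) fun i hi => ?_
  rw [hTι, hTι i, sgn_neg_of_side hT hi hkT]

end Theorems

end IndFlag

theorem corollary5p2 {V : Type*} [AddCommGroup V] [Module ℂ V] (E : Module.Basis ℕ+ ℂ V)
    (D : IndFlag.Datum) (𝓕 : Set (Submodule ℂ V))
    (hmax : IndFlag.IsMaximalGeneralizedFlag 𝓕)
    (hcompat : IndFlag.IsCompatible 𝓕 E)
    (hiso : D.IsotropyCondition E 𝓕) :
    Infinite (IndFlag.OrbitSet (D.G E) (D.K E) 𝓕) ∧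
      Infinite (IndFlag.OrbitSet (D.G E) (D.G0 E) 𝓕) := by
  obtain ⟨A, _, σ, -, rfl⟩ := hcompat
  have hσ := IndFlag.injective_of_isMaximal hmax
  have hch := hmax.1.chain
  cases D with
  | A1 ι block => exact IndFlag.infinite_orbitSets_gamma hσ hch (fun ℓ => (block ℓ).1) (Or.inl rfl)
  | A2 ι block noFix =>
    exact IndFlag.infinite_orbitSets_gamma hσ hch (fun ℓ => (block ℓ).1) (Or.inr ⟨rfl, noFix⟩)
  | A3 N pos neg => exact IndFlag.infinite_orbitSets_delta hσ hch pos neg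
  | BD1 ι block N pos neg stable =>
    exact IndFlag.infinite_orbitSets_of_stable hσ hch (fun ℓ => (block ℓ).1) (Or.inl rfl)
      (fun p q => IndFlag.fixed_unique_of_isIsotropic hσ hiso) pos neg stable
  | C1 ι block noFix N swap =>
    exact IndFlag.infinite_orbitSets_of_swap hσ hch (Or.inr rfl) (fun ℓ => (block ℓ).1) swap
  | C2 ι block noFix N pos neg stable =>
    exact IndFlag.infinite_orbitSets_of_stable hσ hch (fun ℓ => (block ℓ).1) (Or.inr ⟨rfl, noFix⟩)
      (fun p _ hp => absurd hp (noFix p)) pos neg stable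
  | D3 ι block N swap =>
    exact IndFlag.infinite_orbitSets_of_swap hσ hch (Or.inl rfl) (fun ℓ => (block ℓ).1) swap
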